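/- Let $n\ge 2$, let $\omega\subset\mathbb R^{n-1}$ be a bounded Lipschitz domain (a bounded connected open set that near each boundary point is, after a rigid change of coordinates, the strict epigraph of a Lipschitz function), and let $0<\alpha<1$. Let $\eta\in C^{0,\alpha}(\omega)$ (extended continuously to $\overline\omega$) satisfy $\eta(x)\ge\eta_{\min}>0$ for all $x\in\overline\omega$ and $\eta=1$ on $\partial\omega$, and let $$\Omega_\eta=\{(x,x_n): x\in\omega,\ 0<x_n<\eta(x)\}\subset\mathbb R^n .$$ For $u\in C(\overline{\Omega_\eta})$ put $(\gamma_\eta u)(x)=u(x,\eta(x))$, $x\in\omega$. Let $H^1(\Omega_\eta)$ be the space of (real-valued) $u\in L^2(\Omega_\eta)$ with weak gradient in $L^2(\Omega_\eta)$, with $\|u\|_{H^1}^2=\|u\|_{L^2}^2+\|\nabla u\|_{L^2}^2$; let $H^0(\omega)=L^2(\omega)$, and for $0<s<1$ let $H^s(\omega)$ be the space of $u\in L^2(\omega)$ for which $$\|u\|_{H^s(\omega)}^2=\|u\|_{L^2(\omega)}^2+\int_{\omega\times\omega}\frac{|u(x_1)-u(x_2)|^2}{|x_1-x_2|^{n-1+2s}}\,dx_1\,dx_2<\infty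 .$$ Then for every $0\le s<\alpha/2$ the map $\gamma_\eta$ extends by continuity to a bounded linear operator from $H^1(\Omega_\eta)$ to $H^s(\omega)$; that is, $C(\overline{\Omega_\eta})\cap H^1(\Omega_\eta)$ is dense in $H^1(\Omega_\eta)$, and there is exactly one bounded linear operator $T:H^1(\Omega_\eta)\to H^s(\omega)$ with $Tu=\gamma_\eta u$ almost everywhere in $\omega$ for all $u\in C(\overline{\Omega_\eta})\cap H^1(\Omega_\eta)$. -/

import Mathlib

open MeasureTheory
open scoped NNReal ENNReal

/-- Bounded Lipschitz domain in `ℝ^d`: a bounded, connected (nonempty) open set which, near every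
boundary point and after the choice of a "vertical" unit vector `e`, is the strict epigraph of a
Lipschitz function `g` of the component `x - ⟪e, x⟫ e` orthogonal to `e`. -/
structure IsLipschitzDomain {d : ℕ} (ω : Set (EuclideanSpace ℝ (Fin d))) : Prop where
  isOpen : IsOpen ω
  isConnected : IsConnected ω
  isBounded : Bornology.IsBounded ω
  boundary : ∀ p ∈ frontier ω, ∃ e : EuclideanSpace ℝ (Fin d), ‖e‖ = 1 ∧
    ∃ (K : ℝ≥0) (g : EuclideanSpace ℝ (Fin d) → ℝ), LipschitzWith K g ∧
      ∃ r : ℝ, 0 < r ∧ ∀ x ∈ Metric.ball p r,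
        (x ∈ ω ↔ g (x - (inner ℝ e x) • e) < inner ℝ e x)

/-- The subgraph domain `Ω_η = {(x, t) : x ∈ ω, 0 < t < η x}`. The space `ℝ^(d+1)` is written as
`ℝ^d × ℝ`, with Lebesgue (product) measure. -/
def subgraphDomain {d : ℕ} (ω : Set (EuclideanSpace ℝ (Fin d)))
    (η : EuclideanSpace ℝ (Fin d) → ℝ) : Set (EuclideanSpace ℝ (Fin d) × ℝ) :=
  {z | z.1 ∈ ω ∧ 0 < z.2 ∧ z.2 < η z.1}

/-- `G` is the weak gradient of `u` in `Ω ⊆ ℝ^d × ℝ`: for all test functions `φ ∈ C_c^∞(Ω)` and all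
directions `v`, `∫_Ω u ∂_v φ = - ∫_Ω ⟪G, v⟫ φ`. Gradients take values in the Euclidean space
`WithLp 2 (ℝ^d × ℝ)`. -/
def HasWeakGradient {d : ℕ} (Ω : Set (EuclideanSpace ℝ (Fin d) × ℝ))
    (u : EuclideanSpace ℝ (Fin d) × ℝ → ℝ)
    (G : EuclideanSpace ℝ (Fin d) × ℝ → WithLp 2 (EuclideanSpace ℝ (Fin d) × ℝ)) : Prop :=
  ∀ φ : EuclideanSpace ℝ (Fin d) × ℝ → ℝ, ContDiff ℝ ((⊤ : ℕ∞) : WithTop ℕ∞) φ →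
    HasCompactSupport φ → tsupport φ ⊆ Ω →
    ∀ v : WithLp 2 (EuclideanSpace ℝ (Fin d) × ℝ),
      ∫ z in Ω, u z * fderiv ℝ φ z (v.fst, v.snd) = - ∫ z in Ω, inner ℝ (G z) v * φ z

theorem integrable_Lp_mul_of_compactSupport {d : ℕ} {Ω : Set (EuclideanSpace ℝ (Fin d) × ℝ)}
    {f ψ : EuclideanSpace ℝ (Fin d) × ℝ → ℝ} (hf : MemLp f 2 (volume.restrict Ω))
    (hψ : Continuous ψ) (hc : HasCompactSupport ψ) :
    Integrable (fun z => f z * ψ z) (volume.restrict Ω) :=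
  hf.integrable_mul (q := 2) ((hψ.memLp_of_hasCompactSupport hc).restrict Ω)

/-- The Sobolev space `H¹(Ω)`, as the space of pairs `(u, ∇u)` with `u ∈ L²(Ω)` having weak gradient
`∇u ∈ L²(Ω)`. The inherited norm is `‖u‖² = ‖u‖²_{L²} + ‖∇u‖²_{L²}`. -/
noncomputable def H1 {d : ℕ} (Ω : Set (EuclideanSpace ℝ (Fin d) × ℝ)) :
    Submodule ℝ (WithLp 2 (Lp ℝ 2 (volume.restrict Ω) ×
      Lp (WithLp 2 (EuclideanSpace ℝ (Fin d) × ℝ)) 2 (volume.restrict Ω))) where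
  carrier := {U | HasWeakGradient Ω U.fst U.snd}
  zero_mem' := by
    intro φ _ _ _ v
    have h1 : ∫ z in Ω, (0 : Lp ℝ 2 (volume.restrict Ω)) z * fderiv ℝ φ z (v.fst, v.snd) = 0 := by
      refine integral_eq_zero_of_ae ?_
      filter_upwards [Lp.coeFn_zero ℝ 2 (volume.restrict Ω)] with z hz
      simp only [hz, Pi.zero_apply, zero_mul]
    have h2 : ∫ z in Ω, inner ℝ ((0 : Lp (WithLp 2 (EuclideanSpace ℝ (Fin d) × ℝ)) 2
        (volume.restrict Ω)) z) v * φ z = 0 := by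
      refine integral_eq_zero_of_ae ?_
      filter_upwards [Lp.coeFn_zero (WithLp 2 (EuclideanSpace ℝ (Fin d) × ℝ)) 2
        (volume.restrict Ω)] with z hz
      rw [hz, Pi.zero_apply, inner_zero_left, zero_mul, Pi.zero_apply]
    exact h1.trans (by rw [WithLp.zero_snd, h2, neg_zero])
  add_mem' := by
    intro U V hU hV φ h1 h2 h3 v
    have hd : Continuous fun z => fderiv ℝ φ z (v.fst, v.snd) :=
      (h1.continuous_fderiv (by simp)).clm_apply continuous_const
    have hdc : HasCompactSupport fun z => fderiv ℝ φ z (v.fst, v.snd) :=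
      h2.fderiv_apply ℝ (v.fst, v.snd)
    have e1 : ∫ z in Ω, (U + V).fst z * fderiv ℝ φ z (v.fst, v.snd)
        = (∫ z in Ω, U.fst z * fderiv ℝ φ z (v.fst, v.snd))
          + ∫ z in Ω, V.fst z * fderiv ℝ φ z (v.fst, v.snd) := by
      rw [← integral_add (integrable_Lp_mul_of_compactSupport (Lp.memLp _) hd hdc)
        (integrable_Lp_mul_of_compactSupport (Lp.memLp _) hd hdc)]
      refine integral_congr_ae ?_
      filter_upwards [Lp.coeFn_add U.fst V.fst] with z hz
      rw [WithLp.add_fst, hz, Pi.add_apply, add_mul]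
    have e2 : ∫ z in Ω, inner ℝ ((U + V).snd z) v * φ z
        = (∫ z in Ω, inner ℝ (U.snd z) v * φ z) + ∫ z in Ω, inner ℝ (V.snd z) v * φ z := by
      rw [← integral_add
        (integrable_Lp_mul_of_compactSupport ((Lp.memLp _).inner_const v) h1.continuous h2)
        (integrable_Lp_mul_of_compactSupport ((Lp.memLp _).inner_const v) h1.continuous h2)]
      refine integral_congr_ae ?_
      filter_upwards [Lp.coeFn_add U.snd V.snd] with z hz
      rw [WithLp.add_snd, hz, Pi.add_apply, inner_add_left, add_mul]
    rw [e1, e2, hU φ h1 h2 h3 v, hV φ h1 h2 h3 v, neg_add]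
  smul_mem' := by
    intro c U hU φ h1 h2 h3 v
    have e1 : ∫ z in Ω, (c • U).fst z * fderiv ℝ φ z (v.fst, v.snd)
        = c * ∫ z in Ω, U.fst z * fderiv ℝ φ z (v.fst, v.snd) := by
      rw [← integral_const_mul]
      refine integral_congr_ae ?_
      filter_upwards [Lp.coeFn_smul c U.fst] with z hz
      rw [WithLp.smul_fst, hz, Pi.smul_apply, smul_eq_mul, mul_assoc]
    have e2 : ∫ z in Ω, inner ℝ ((c • U).snd z) v * φ z
        = c * ∫ z in Ω, inner ℝ (U.snd z) v * φ z := by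
      rw [← integral_const_mul]
      refine integral_congr_ae ?_
      filter_upwards [Lp.coeFn_smul c U.snd] with z hz
      rw [WithLp.smul_snd, hz, Pi.smul_apply, real_inner_smul_left, mul_assoc]
    rw [e1, e2, hU φ h1 h2 h3 v, mul_neg]

open Classical in
/-- The difference quotient `(u x - u y) / |x - y|^(d/2 + s)`, whose squared `L²(ω × ω)` norm is the
Gagliardo–Slobodeckij seminorm `∫∫ |u x - u y|² / |x - y|^(d + 2s)`. For `s = 0` it is replaced by
`0`, so that `H⁰ = L²`. -/
noncomputable def slobodeckijQuotient {d : ℕ} (s : ℝ) (u : EuclideanSpace ℝ (Fin d) → ℝ)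
    (p : EuclideanSpace ℝ (Fin d) × EuclideanSpace ℝ (Fin d)) : ℝ :=
  if s = 0 then 0 else (u p.1 - u p.2) / ‖p.1 - p.2‖ ^ ((d : ℝ) / 2 + s)

/-- The Sobolev space `H^s(ω)`, `0 ≤ s < 1`, with its intrinsic norm: the space of `u ∈ L²(ω)` whose
difference quotient is in `L²(ω × ω)`, each `u` being paired with that quotient. The inherited norm
is `‖u‖² = ‖u‖²_{L²(ω)} + ∫_{ω × ω} |u x - u y|² / |x - y|^(d + 2s)` for `0 < s < 1`, and the `L²`
norm for `s = 0`. -/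
noncomputable def Hs {d : ℕ} (ω : Set (EuclideanSpace ℝ (Fin d))) (s : ℝ) :
    Submodule ℝ (WithLp 2 (Lp ℝ 2 (volume.restrict ω) ×
      Lp ℝ 2 ((volume.restrict ω).prod (volume.restrict ω)))) where
  carrier := {U | U.snd =ᵐ[(volume.restrict ω).prod (volume.restrict ω)]
    slobodeckijQuotient s U.fst}
  zero_mem' := by
    have h := Lp.coeFn_zero ℝ 2 (volume.restrict ω)
    have h1 := Measure.quasiMeasurePreserving_fst (μ := volume.restrict ω)
      (ν := volume.restrict ω) |>.ae h
    have h2 := Measure.quasiMeasurePreserving_snd (μ := volume.restrict ω)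
      (ν := volume.restrict ω) |>.ae h
    change ((0 : Lp ℝ 2 ((volume.restrict ω).prod (volume.restrict ω))) : _ → ℝ) =ᵐ[_]
      slobodeckijQuotient s (0 : Lp ℝ 2 (volume.restrict ω))
    filter_upwards [h1, h2, Lp.coeFn_zero ℝ 2 ((volume.restrict ω).prod (volume.restrict ω))]
      with p hp1 hp2 hp
    simp only [slobodeckijQuotient, hp1, hp2, hp, Pi.zero_apply]
    simp
  add_mem' := by
    intro U V hU hV
    have h := Lp.coeFn_add U.fst V.fst
    have h1 := Measure.quasiMeasurePreserving_fst (μ := volume.restrict ω)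
      (ν := volume.restrict ω) |>.ae h
    have h2 := Measure.quasiMeasurePreserving_snd (μ := volume.restrict ω)
      (ν := volume.restrict ω) |>.ae h
    change ((U.snd + V.snd : Lp ℝ 2 _) : _ → ℝ) =ᵐ[_]
      slobodeckijQuotient s (U.fst + V.fst : Lp ℝ 2 _)
    filter_upwards [h1, h2, Lp.coeFn_add U.snd V.snd, hU, hV] with p hp1 hp2 hp hpU hpV
    rw [hp, Pi.add_apply, hpU, hpV]
    simp only [slobodeckijQuotient, hp1, hp2, Pi.add_apply]
    split_ifs <;> ring
  smul_mem' := by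
    intro c U hU
    have h := Lp.coeFn_smul c U.fst
    have h1 := Measure.quasiMeasurePreserving_fst (μ := volume.restrict ω)
      (ν := volume.restrict ω) |>.ae h
    have h2 := Measure.quasiMeasurePreserving_snd (μ := volume.restrict ω)
      (ν := volume.restrict ω) |>.ae h
    change ((c • U.snd : Lp ℝ 2 _) : _ → ℝ) =ᵐ[_]
      slobodeckijQuotient s (c • U.fst : Lp ℝ 2 _)
    filter_upwards [h1, h2, Lp.coeFn_smul c U.snd, hU] with p hp1 hp2 hp hpU
    rw [hp, Pi.smul_apply, hpU]
    simp only [slobodeckijQuotient, hp1, hp2, Pi.smul_apply, smul_eq_mul]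
    split_ifs <;> ring

/-- The trace `(γ_η f)(x) = f (x, η x)` of a function `f` continuous on the closure of `Ω_η`. -/
def graphTrace {d : ℕ} (η : EuclideanSpace ℝ (Fin d) → ℝ)
    (f : EuclideanSpace ℝ (Fin d) × ℝ → ℝ) (x : EuclideanSpace ℝ (Fin d)) : ℝ :=
  f (x, η x)

/-- `U ∈ H¹(Ω)` is (a.e. on `Ω` equal to) the function `f ∈ C(closure Ω)`. -/
def IsContinuousRep {d : ℕ} {Ω : Set (EuclideanSpace ℝ (Fin d) × ℝ)} (U : H1 Ω)
    (f : EuclideanSpace ℝ (Fin d) × ℝ → ℝ) : Prop :=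
  ContinuousOn f (closure Ω) ∧ U.1.fst =ᵐ[volume.restrict Ω] f

/-! Trace inequality. For a `C¹` function φ let Γ(x) be the integral of |∇φ|² over the vertical
slice of Ω_η at x, so that ∫ Γ = ‖∇φ‖². Let x, y ∈ ω be at small distance r. By the Hölder condition
the graph varies by at most l ~ r^α near x, so at heights between l and 2l below (x, η x) one can
travel horizontally above nearby points of ω without leaving Ω_η. Going down at x, across, and up at
y, with Cauchy–Schwarz on each leg and an average over these heights, gives |γφ(x) − γφ(y)|² ≲ (l +
r²/l) P ≲ r^α P, where P collects values and segment averages of Γ (`enorm_graphTrace_sub_sq_le`).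
The horizontal path is the detour x → x+b → y+b → y, with b in an interior cone direction, which
keeps it over ω. For fixed h = y − x the x-integral of P is 5‖∇φ‖² by translation invariance, so the
near part of the Gagliardo integral is at most a constant times ‖∇φ‖² ∫ |h|^(α−2s−d) dh, and the
kernel is integrable at 0 because 2s < α. Far pairs are controlled by the L² norm of the trace.

Density. Extend u by zero, compose with a map that moves inward along a cone direction and
compresses vertically, mollify, and patch the local pieces by a partition of unity in the horizontal
variable (`exists_contDiff_approx`). The moved closed subgraph has room below the graph, so the
mollifier never sees the zero extension. The result is `C¹` on the whole space and close to u in H¹.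
On the graph it averages nearby values of u, hence is uniformly close to a continuous
representative.

Conclusion. The trace on `C¹` functions extends by density and completeness of H^s. The uniform
approximation on the graph identifies the extension on every continuous representative, and density
of these gives uniqueness. -/

section

open Metric Set Filter Topology
open scoped Convolution

variable {d : ℕ}

local notation "𝔼" => EuclideanSpace ℝ (Fin d)

/-! ### Interior cone condition -/

/-- Interior cone condition: near each point of its closure, a Lipschitz domain contains the balls
`ball (x + ε • v) ε`, with `v` locally constant. -/
theorem IsLipschitzDomain.exists_cone {d : ℕ} {ω : Set (EuclideanSpace ℝ (Fin d))}
    (hω : IsLipschitzDomain ω) {p : EuclideanSpace ℝ (Fin d)} (hp : p ∈ closure ω) :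
    ∃ v : EuclideanSpace ℝ (Fin d), ∃ ρ > 0, ∀ x ∈ ω, dist x p < ρ → ∀ ε, 0 < ε → ε < ρ →
      ball (x + ε • v) ε ⊆ ω := by
  by_cases hpω : p ∈ ω
  · obtain ⟨R, hR, hRω⟩ := Metric.isOpen_iff.1 hω.isOpen p hpω
    refine ⟨0, R / 2, by positivity, fun x _ hxp ε _ hε y hy => hRω ?_⟩
    rw [smul_zero, add_zero, mem_ball] at hy
    rw [mem_ball]
    linarith [dist_triangle y x p]
  · have hpf : p ∈ frontier ω := ⟨hp, by rwa [hω.isOpen.interior_eq]⟩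
    obtain ⟨e, he, K, g, hg, r, hr, hgr⟩ := hω.boundary p hpf
    have hK : (0 : ℝ) ≤ K := K.2
    -- A perturbation w with ‖w‖ < ε raises `g` by at most Kε and lowers the height by less than ε,
    -- so a lift of ε(K + 1) along `e` compensates both. The total displacement from `p` is below ρ
    -- + ρ(K + 1) + ρ = r when ρ = r/(K + 3).
    refine ⟨((K : ℝ) + 1) • e, r / (K + 3), by positivity, fun x hx hxp ε hε hερ y hy => ?_⟩
    have hr' : r / (K + 3) * (K + 3) = r := by field_simp
    obtain ⟨w, rfl⟩ : ∃ w, y = x + ε • ((K : ℝ) + 1) • e + w := ⟨y - (x + ε • ((K : ℝ) + 1) • e), by abel⟩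
    have hw : ‖w‖ < ε := by simpa [mem_ball, dist_eq_norm] using hy
    have hve : ‖ε • ((K : ℝ) + 1) • e‖ = ε * (K + 1) := by
      rw [norm_smul, norm_smul, he, Real.norm_of_nonneg hε.le, Real.norm_of_nonneg (by positivity),
        mul_one]
    have hxr : x ∈ ball p r := by
      rw [mem_ball]
      nlinarith [div_pos hr (by positivity : (0:ℝ) < K + 3)]
    have hyr : x + ε • ((K : ℝ) + 1) • e + w ∈ ball p r := by
      rw [mem_ball, dist_eq_norm]
      have h1 : x + ε • ((K : ℝ) + 1) • e + w - p = (x - p) + ε • ((K : ℝ) + 1) • e + w := by abel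
      rw [h1]
      have h2 := norm_add₃_le (a := x - p) (b := ε • ((K : ℝ) + 1) • e) (c := w)
      rw [hve] at h2
      rw [dist_eq_norm] at hxp
      nlinarith
    rw [hgr _ hyr]
    have hgx := (hgr x hxr).1 hx
    have hee : inner ℝ e e = (1 : ℝ) := by rw [real_inner_self_eq_norm_sq, he, one_pow]
    have hinner : inner ℝ e (x + ε • ((K : ℝ) + 1) • e + w)
        = inner ℝ e x + ε * (K + 1) + inner ℝ e w := by
      rw [inner_add_right, inner_add_right, real_inner_smul_right, real_inner_smul_right, hee,
        mul_one]
    have hew : |inner ℝ e w| ≤ ‖w‖ := by simpa [he] using abs_real_inner_le_norm e w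
    have hproj : ‖w - (inner ℝ e w : ℝ) • e‖ ≤ ‖w‖ := by
      refine (pow_le_pow_iff_left₀ (norm_nonneg _) (norm_nonneg _) two_ne_zero).1 ?_
      rw [norm_sub_sq_real, real_inner_smul_right, norm_smul, he, mul_one, Real.norm_eq_abs, sq_abs,
        real_inner_comm]
      nlinarith [sq_nonneg (inner ℝ e w : ℝ)]
    have hlip := hg.dist_le_mul (x + ε • ((K : ℝ) + 1) • e + w
      - (inner ℝ e (x + ε • ((K : ℝ) + 1) • e + w) : ℝ) • e) (x - (inner ℝ e x : ℝ) • e)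
    rw [dist_eq_norm, hinner] at hlip
    have h3 : x + ε • ((K : ℝ) + 1) • e + w - (inner ℝ e x + ε * (K + 1) + inner ℝ e w) • e
        - (x - (inner ℝ e x : ℝ) • e) = w - (inner ℝ e w : ℝ) • e := by
      rw [smul_smul, add_smul, add_smul]; abel
    rw [dist_eq_norm, h3, Real.norm_eq_abs] at hlip
    rw [hinner]
    have h4 := (abs_le.1 hew).1
    have h5 := (abs_le.1 hlip).2
    nlinarith [mul_le_mul_of_nonneg_left hproj hK]

/-- Compactness of the closure. Halving the radii leaves the margin ρ beyond `r p`, so that two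
points at distance less than ρ, the first in `ball p (r p)`, share the direction `v p`. The detour
between them needs this. -/
theorem IsLipschitzDomain.exists_finite_cone_cover {d : ℕ} {ω : Set (EuclideanSpace ℝ (Fin d))}
    (hω : IsLipschitzDomain ω) :
    ∃ (t : Finset (EuclideanSpace ℝ (Fin d))) (r : EuclideanSpace ℝ (Fin d) → ℝ)
      (v : EuclideanSpace ℝ (Fin d) → EuclideanSpace ℝ (Fin d)) (ρ : ℝ), 0 < ρ ∧
      closure ω ⊆ ⋃ p ∈ t, ball p (r p) ∧
      ∀ p ∈ t, ∀ x ∈ ω, dist x p < r p + ρ → ∀ ε, 0 < ε → ε < ρ → ball (x + ε • v p) ε ⊆ ω := by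
  choose! v R hR hcone using fun p (hp : p ∈ closure ω) => hω.exists_cone hp
  obtain ⟨t, htω, ht⟩ := hω.isBounded.isCompact_closure.elim_nhds_subcover
    (fun p => ball p (R p / 2)) (fun p hp => ball_mem_nhds p (half_pos (hR p hp)))
  have hρ : ∀ᶠ ρ in 𝓝[>] (0 : ℝ), 0 < ρ ∧ ∀ p ∈ t, ρ < R p / 2 := by
    refine (eventually_mem_nhdsWithin).and ((Finset.eventually_all t).2 fun p hp => ?_)
    exact eventually_nhdsWithin_of_eventually_nhds (eventually_lt_nhds (half_pos (hR p (htω p hp))))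
  obtain ⟨ρ, hρ0, hρ⟩ := hρ.exists
  refine ⟨t, fun p => R p / 2, v, ρ, hρ0, ht, fun p hp x hx hxp ε hε hερ => ?_⟩
  have := hρ p hp
  exact hcone p (htω p hp) x hx (by linarith) ε hε (by linarith)

/-! ### The subgraph domain and square inequalities -/

theorem isOpen_subgraphDomain {d : ℕ} {ω : Set (EuclideanSpace ℝ (Fin d))}
    {η : EuclideanSpace ℝ (Fin d) → ℝ} (hω : IsOpen ω) (hη : ContinuousOn η ω) :
    IsOpen (subgraphDomain ω η) := by
  have h1 : IsOpen (Prod.fst ⁻¹' ω : Set (EuclideanSpace ℝ (Fin d) × ℝ)) :=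
    hω.preimage continuous_fst
  have h2 : ContinuousOn (fun z : EuclideanSpace ℝ (Fin d) × ℝ => η z.1 - z.2) (Prod.fst ⁻¹' ω) :=
    (hη.comp continuousOn_fst fun z hz => hz).sub continuousOn_snd
  have h3 := (h2.isOpen_inter_preimage h1 isOpen_Ioi (t := Ioi 0)).inter
    (isOpen_Ioi.preimage continuous_snd (t := Ioi (0:ℝ)))
  convert h3 using 1
  ext z
  simp only [subgraphDomain, mem_ofPred_eq, mem_inter_iff, mem_preimage, mem_Ioi, sub_pos]
  tauto

theorem isBounded_subgraphDomain {d : ℕ} {ω : Set (EuclideanSpace ℝ (Fin d))}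
    {η : EuclideanSpace ℝ (Fin d) → ℝ} (hω : Bornology.IsBounded ω)
    (hη : ContinuousOn η (closure ω)) : Bornology.IsBounded (subgraphDomain ω η) := by
  obtain ⟨M, hM⟩ := hω.isCompact_closure.exists_bound_of_continuousOn hη
  refine (hω.prod (isBounded_Icc 0 M)).subset fun z hz => ⟨hz.1, hz.2.1.le, ?_⟩
  exact hz.2.2.le.trans ((le_abs_self _).trans (hM z.1 (subset_closure hz.1)))

theorem lintegral_sq_le {X : Type*} [MeasurableSpace X] (μ : Measure X) {g : X → ℝ≥0∞}
    (hg : AEMeasurable g μ) : (∫⁻ x, g x ∂μ) ^ 2 ≤ μ univ * ∫⁻ x, g x ^ 2 ∂μ := by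
  have h := ENNReal.lintegral_mul_le_Lp_mul_Lq μ Real.HolderConjugate.two_two hg
    (aemeasurable_const (b := (1 : ℝ≥0∞)))
  simp only [Pi.mul_apply, mul_one, ENNReal.one_rpow, lintegral_const, one_mul] at h
  calc (∫⁻ x, g x ∂μ) ^ 2
      ≤ ((∫⁻ x, g x ^ (2 : ℝ) ∂μ) ^ (1 / (2 : ℝ)) * μ univ ^ (1 / (2 : ℝ))) ^ 2 := by gcongr
    _ = μ univ * ∫⁻ x, g x ^ 2 ∂μ := by
      rw [mul_pow, ← ENNReal.rpow_natCast, ← ENNReal.rpow_natCast, ← ENNReal.rpow_mul,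
        ← ENNReal.rpow_mul]
      norm_num
      rw [mul_comm]

theorem enorm_sq_eq_ofReal (x : ℝ) : ‖x‖ₑ ^ 2 = ENNReal.ofReal (x ^ 2) := by
  rw [Real.enorm_eq_ofReal_abs, ← ENNReal.ofReal_pow (abs_nonneg x), sq_abs]

theorem enorm_add_sq_le (a b : ℝ) : ‖a + b‖ₑ ^ 2 ≤ 2 * (‖a‖ₑ ^ 2 + ‖b‖ₑ ^ 2) := by
  simp only [enorm_sq_eq_ofReal]
  rw [← ENNReal.ofReal_add (by positivity) (by positivity), ← ENNReal.ofReal_ofNat,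
    ← ENNReal.ofReal_mul (by positivity)]
  exact ENNReal.ofReal_le_ofReal (by nlinarith [sq_nonneg (a - b)])

theorem enorm_add_five_sq_le (a b c e f : ℝ) : ‖a + b + c + e + f‖ₑ ^ 2
    ≤ 5 * (‖a‖ₑ ^ 2 + ‖b‖ₑ ^ 2 + ‖c‖ₑ ^ 2 + ‖e‖ₑ ^ 2 + ‖f‖ₑ ^ 2) := by
  simp only [enorm_sq_eq_ofReal]
  rw [← ENNReal.ofReal_add (by positivity) (by positivity),
    ← ENNReal.ofReal_add (by positivity) (by positivity),
    ← ENNReal.ofReal_add (by positivity) (by positivity),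
    ← ENNReal.ofReal_add (by positivity) (by positivity), ← ENNReal.ofReal_ofNat,
    ← ENNReal.ofReal_mul (by positivity)]
  refine ENNReal.ofReal_le_ofReal ?_
  nlinarith [sq_nonneg (a - b), sq_nonneg (a - c), sq_nonneg (a - e), sq_nonneg (a - f),
    sq_nonneg (b - c), sq_nonneg (b - e), sq_nonneg (b - f), sq_nonneg (c - e), sq_nonneg (c - f),
    sq_nonneg (e - f)]

theorem enorm_sub_sq_le_lintegral_deriv {f f' : ℝ → ℝ} (hf : ∀ t, HasDerivAt f (f' t) t)
    (hf' : Continuous f') {a b : ℝ} (hab : a ≤ b) :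
    ‖f b - f a‖ₑ ^ 2 ≤ ENNReal.ofReal (b - a) * ∫⁻ t in Ioc a b, ‖f' t‖ₑ ^ 2 := by
  have h1 : ∫ t in a..b, f' t = f b - f a :=
    intervalIntegral.integral_eq_sub_of_hasDerivAt (fun t _ => hf t) (hf'.intervalIntegrable a b)
  rw [← h1, intervalIntegral.integral_of_le hab]
  calc ‖∫ t in Ioc a b, f' t‖ₑ ^ 2 ≤ (∫⁻ t in Ioc a b, ‖f' t‖ₑ) ^ 2 := by
        gcongr; exact enorm_integral_le_lintegral_enorm _
    _ ≤ (volume.restrict (Ioc a b)) univ * ∫⁻ t in Ioc a b, ‖f' t‖ₑ ^ 2 :=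
        lintegral_sq_le _ hf'.enorm.measurable.aemeasurable
    _ = _ := by rw [Measure.restrict_apply_univ, Real.volume_Ioc]

/-! ### Increments of `C¹` functions along vertical and horizontal segments -/

/-- The gradient of `φ : ℝ^d × ℝ → ℝ` with values in the Euclidean product. -/
noncomputable def prodGradient (φ : 𝔼 × ℝ → ℝ) (z : 𝔼 × ℝ) : WithLp 2 (𝔼 × ℝ) :=
  (InnerProductSpace.toDual ℝ (WithLp 2 (𝔼 × ℝ))).symm
    (fderiv ℝ φ z ∘L (WithLp.prodContinuousLinearEquiv 2 ℝ 𝔼 ℝ).toContinuousLinearMap)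

theorem inner_prodGradient (φ : 𝔼 × ℝ → ℝ) (z : 𝔼 × ℝ) (v : WithLp 2 (𝔼 × ℝ)) :
    inner ℝ (prodGradient φ z) v = fderiv ℝ φ z (v.fst, v.snd) := by
  rw [prodGradient, InnerProductSpace.toDual_symm_apply]
  rfl

theorem continuous_prodGradient {φ : 𝔼 × ℝ → ℝ} (hφ : ContDiff ℝ 1 φ) :
    Continuous (prodGradient φ) := by
  refine (LinearIsometryEquiv.continuous _).comp ?_
  exact (hφ.continuous_fderiv one_ne_zero).clm_comp continuous_const

theorem enorm_fderiv_vertical_le (φ : 𝔼 × ℝ → ℝ) (z : 𝔼 × ℝ) :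
    ‖fderiv ℝ φ z (0, 1)‖ₑ ≤ ‖prodGradient φ z‖ₑ := by
  have h := inner_prodGradient φ z (WithLp.toLp 2 ((0 : 𝔼), (1 : ℝ)))
  have h2 := norm_inner_le_norm (𝕜 := ℝ) (prodGradient φ z) (WithLp.toLp 2 ((0 : 𝔼), (1 : ℝ)))
  rw [h, WithLp.prod_norm_eq_of_L2 (WithLp.toLp 2 ((0 : 𝔼), (1 : ℝ)))] at h2
  rw [enorm_le_iff_norm_le]
  simpa using h2

theorem enorm_fderiv_horizontal_le (φ : 𝔼 × ℝ → ℝ) (z : 𝔼 × ℝ) (a : 𝔼) :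
    ‖fderiv ℝ φ z (a, 0)‖ₑ ≤ ‖a‖ₑ * ‖prodGradient φ z‖ₑ := by
  have h := inner_prodGradient φ z (WithLp.toLp 2 (a, (0 : ℝ)))
  have h2 := norm_inner_le_norm (𝕜 := ℝ) (prodGradient φ z) (WithLp.toLp 2 (a, (0 : ℝ)))
  rw [h, WithLp.prod_norm_eq_of_L2 (WithLp.toLp 2 (a, (0 : ℝ)))] at h2
  rw [← enorm_norm a, ← enorm_norm (prodGradient φ z), ← enorm_mul, enorm_le_iff_norm_le, norm_mul,
    norm_norm, norm_norm, mul_comm]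
  simpa using h2

/-- The integral of `F` over the vertical slice of `Ω` at `w`. -/
noncomputable def sliceIntegral (Ω : Set (𝔼 × ℝ)) (F : 𝔼 × ℝ → ℝ≥0∞) (w : 𝔼) : ℝ≥0∞ :=
  ∫⁻ θ, Ω.indicator F (w, θ)

theorem measurable_sliceIntegral {Ω : Set (𝔼 × ℝ)} (hΩ : MeasurableSet Ω) {F : 𝔼 × ℝ → ℝ≥0∞}
    (hF : Measurable F) : Measurable (sliceIntegral Ω F) :=
  (hF.indicator hΩ).lintegral_prod_right'

theorem lintegral_sliceIntegral {Ω : Set (𝔼 × ℝ)} (hΩ : MeasurableSet Ω) {F : 𝔼 × ℝ → ℝ≥0∞}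
    (hF : Measurable F) : ∫⁻ w, sliceIntegral Ω F w = ∫⁻ z in Ω, F z := by
  rw [← lintegral_indicator hΩ, Measure.volume_eq_prod, lintegral_prod _ (hF.indicator hΩ).aemeasurable]
  rfl

/-- Only the open segment has to lie in Ω: φ is `C¹` on the whole space, so `b` may be the height of
the graph itself. -/
theorem enorm_vertical_sub_sq_le {Ω : Set (𝔼 × ℝ)} {φ : 𝔼 × ℝ → ℝ} (hφ : ContDiff ℝ 1 φ) {x : 𝔼}
    {a b : ℝ} (hab : a ≤ b) (h : ∀ t ∈ Ioo a b, (x, t) ∈ Ω) :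
    ‖φ (x, b) - φ (x, a)‖ₑ ^ 2
      ≤ ENNReal.ofReal (b - a) * sliceIntegral Ω (fun z => ‖prodGradient φ z‖ₑ ^ 2) x := by
  have hd : ∀ t : ℝ, HasDerivAt (fun t => φ (x, t)) (fderiv ℝ φ (x, t) (0, 1)) t := fun t =>
    ((hφ.differentiable one_ne_zero) (x, t)).hasFDerivAt.comp_hasDerivAt t
      ((hasDerivAt_const t x).prodMk (hasDerivAt_id t))
  have hc : Continuous fun t : ℝ => fderiv ℝ φ (x, t) (0, 1) :=
    ((hφ.continuous_fderiv one_ne_zero).comp (by fun_prop)).clm_apply continuous_const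
  refine (enorm_sub_sq_le_lintegral_deriv hd hc hab).trans ?_
  gcongr
  rw [setLIntegral_congr Ioo_ae_eq_Ioc.symm, ← lintegral_indicator measurableSet_Ioo]
  refine lintegral_mono fun t => ?_
  by_cases ht : t ∈ Ioo a b
  · rw [indicator_of_mem ht, indicator_of_mem (h t ht)]
    gcongr
    exact enorm_fderiv_vertical_le φ _
  · rw [indicator_of_notMem ht]
    exact zero_le

theorem enorm_horizontal_sub_sq_le {Ω : Set (𝔼 × ℝ)} {φ : 𝔼 × ℝ → ℝ} (hφ : ContDiff ℝ 1 φ)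
    {x a : 𝔼} {θ : ℝ} (h : ∀ σ ∈ Ioo (0 : ℝ) 1, (x + σ • a, θ) ∈ Ω) :
    ‖φ (x + a, θ) - φ (x, θ)‖ₑ ^ 2
      ≤ ‖a‖ₑ ^ 2 * ∫⁻ σ in Ioo (0 : ℝ) 1,
        Ω.indicator (fun z => ‖prodGradient φ z‖ₑ ^ 2) (x + σ • a, θ) := by
  have hd : ∀ t : ℝ, HasDerivAt (fun t : ℝ => φ (x + t • a, θ))
      (fderiv ℝ φ (x + t • a, θ) (a, 0)) t := fun t =>
    ((hφ.differentiable one_ne_zero) (x + t • a, θ)).hasFDerivAt.comp_hasDerivAt t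
      ((by simpa using ((hasDerivAt_id t).smul_const a).const_add x :
        HasDerivAt (fun t : ℝ => x + t • a) a t).prodMk (hasDerivAt_const t θ))
  have hc : Continuous fun t : ℝ => fderiv ℝ φ (x + t • a, θ) (a, 0) :=
    ((hφ.continuous_fderiv one_ne_zero).comp (by fun_prop)).clm_apply continuous_const
  have h1 := enorm_sub_sq_le_lintegral_deriv hd hc zero_le_one
  simp only [one_smul, zero_smul, add_zero, sub_zero, ENNReal.ofReal_one, one_mul] at h1
  refine h1.trans ?_
  rw [← lintegral_const_mul' _ _ (by simp), setLIntegral_congr Ioo_ae_eq_Ioc.symm]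
  refine setLIntegral_mono' measurableSet_Ioo fun σ hσ => ?_
  rw [indicator_of_mem (h σ hσ), ← mul_pow]
  gcongr
  exact enorm_fderiv_horizontal_le φ _ a

/-- The average of `Γ` over the segment from `x` to `x + a`. -/
noncomputable def segmentAverage (Γ : 𝔼 → ℝ≥0∞) (x a : 𝔼) : ℝ≥0∞ :=
  ∫⁻ σ in Ioo (0 : ℝ) 1, Γ (x + σ • a)

/-- At a single height the gradient on a horizontal segment is not controlled by slice integrals.
Integration over the heights, with Tonelli, turns it into an average of them. -/
theorem lintegral_enorm_horizontal_sub_sq_le {Ω : Set (𝔼 × ℝ)} (hΩ : MeasurableSet Ω)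
    {φ : 𝔼 × ℝ → ℝ} (hφ : ContDiff ℝ 1 φ) {x a : 𝔼} {S : Set ℝ} (hS : MeasurableSet S)
    (h : ∀ θ ∈ S, ∀ σ ∈ Ioo (0 : ℝ) 1, (x + σ • a, θ) ∈ Ω) :
    ∫⁻ θ in S, ‖φ (x + a, θ) - φ (x, θ)‖ₑ ^ 2
      ≤ ‖a‖ₑ ^ 2 * segmentAverage (sliceIntegral Ω fun z => ‖prodGradient φ z‖ₑ ^ 2) x a := by
  have hm : Measurable (Ω.indicator fun z => ‖prodGradient φ z‖ₑ ^ 2) :=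
    ((continuous_prodGradient hφ).enorm.measurable.pow_const 2).indicator hΩ
  calc ∫⁻ θ in S, ‖φ (x + a, θ) - φ (x, θ)‖ₑ ^ 2
      ≤ ∫⁻ θ in S, ‖a‖ₑ ^ 2 * ∫⁻ σ in Ioo (0 : ℝ) 1,
        Ω.indicator (fun z => ‖prodGradient φ z‖ₑ ^ 2) (x + σ • a, θ) :=
        setLIntegral_mono' hS fun θ hθ => enorm_horizontal_sub_sq_le hφ (h θ hθ)
    _ ≤ ∫⁻ θ, ‖a‖ₑ ^ 2 * ∫⁻ σ in Ioo (0 : ℝ) 1,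
        Ω.indicator (fun z => ‖prodGradient φ z‖ₑ ^ 2) (x + σ • a, θ) := setLIntegral_le_lintegral _ _
    _ = _ := by
      rw [lintegral_const_mul' _ _ (by simp), lintegral_lintegral_swap]
      · rfl
      · refine Measurable.aemeasurable (hm.comp ?_)
        fun_prop

/-- Five legs: down at x to height θ, then x → x+b → y+b → y at that height, then up at y. The
estimate is integrated over θ in an interval of length l, which is the factor on the left. -/
theorem ofReal_mul_enorm_graphTrace_sub_sq_le {ω : Set 𝔼} {η : 𝔼 → ℝ}
    (hΩ : MeasurableSet (subgraphDomain ω η)) {φ : 𝔼 × ℝ → ℝ} (hφ : ContDiff ℝ 1 φ) {x y b : 𝔼}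
    (hx : x ∈ ω) (hy : y ∈ ω) {l : ℝ} (hlx : 2 * l ≤ η x) (hxy : |η y - η x| ≤ l)
    (h1 : ∀ σ ∈ Ioo (0 : ℝ) 1, x + σ • b ∈ ω ∧ η x - l ≤ η (x + σ • b))
    (h2 : ∀ σ ∈ Ioo (0 : ℝ) 1, x + b + σ • (y - x) ∈ ω ∧ η x - l ≤ η (x + b + σ • (y - x)))
    (h3 : ∀ σ ∈ Ioo (0 : ℝ) 1, y + σ • b ∈ ω ∧ η x - l ≤ η (y + σ • b)) :
    letI Γ := sliceIntegral (subgraphDomain ω η) fun z => ‖prodGradient φ z‖ₑ ^ 2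
    ENNReal.ofReal l * ‖graphTrace η φ x - graphTrace η φ y‖ₑ ^ 2
      ≤ 5 * (ENNReal.ofReal l * (ENNReal.ofReal (2 * l) * Γ x) + ‖b‖ₑ ^ 2 * segmentAverage Γ x b
        + ‖y - x‖ₑ ^ 2 * segmentAverage Γ (x + b) (y - x) + ‖b‖ₑ ^ 2 * segmentAverage Γ y b
        + ENNReal.ofReal l * (ENNReal.ofReal (3 * l) * Γ y)) := by
  set Γ := sliceIntegral (subgraphDomain ω η) fun z => ‖prodGradient φ z‖ₑ ^ 2 with hΓ
  have hyx := abs_le.1 hxy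
  -- The upper end η x − l is below the graph at every base point of the path, and the lower end is
  -- nonnegative because 2l ≤ η x.
  set S : Set ℝ := Ioo (η x - 2 * l) (η x - l) with hS
  have hSm : MeasurableSet S := measurableSet_Ioo
  have hvol : volume S = ENNReal.ofReal l := by
    rw [hS, Real.volume_Ioo]; congr 1; ring
  have hcont : Continuous φ := hφ.continuous
  have hmeas : ∀ u w : 𝔼, Measurable fun θ : ℝ => ‖φ (u, θ) - φ (w, θ)‖ₑ ^ 2 := fun u w => by
    have : Continuous fun θ : ℝ => φ (u, θ) - φ (w, θ) := by fun_prop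
    exact this.enorm.measurable.pow_const 2
  have hpt : ∀ θ ∈ S, ‖graphTrace η φ x - graphTrace η φ y‖ₑ ^ 2 ≤
      5 * (ENNReal.ofReal (2 * l) * Γ x + ‖φ (x + b, θ) - φ (x, θ)‖ₑ ^ 2
        + ‖φ (x + b + (y - x), θ) - φ (x + b, θ)‖ₑ ^ 2 + ‖φ (y + b, θ) - φ (y, θ)‖ₑ ^ 2
        + ENNReal.ofReal (3 * l) * Γ y) := by
    intro θ hθ
    obtain ⟨hθ1, hθ2⟩ := hθ
    have hA : ‖φ (x, η x) - φ (x, θ)‖ₑ ^ 2 ≤ ENNReal.ofReal (2 * l) * Γ x :=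
      (enorm_vertical_sub_sq_le hφ (by linarith) fun t ht =>
        (⟨hx, by linarith [ht.1], ht.2⟩ : (x, t) ∈ subgraphDomain ω η)).trans
        (by gcongr; linarith)
    -- The last leg has length at most 3l, since η y ≤ η x + l and θ > η x − 2l.
    have hB : ‖φ (y, η y) - φ (y, θ)‖ₑ ^ 2 ≤ ENNReal.ofReal (3 * l) * Γ y :=
      (enorm_vertical_sub_sq_le hφ (by linarith) fun t ht =>
        (⟨hy, by linarith [ht.1], ht.2⟩ : (y, t) ∈ subgraphDomain ω η)).trans
        (by gcongr; linarith)
    have hdecomp : graphTrace η φ x - graphTrace η φ y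
        = (φ (x, η x) - φ (x, θ)) + -(φ (x + b, θ) - φ (x, θ))
          + -(φ (x + b + (y - x), θ) - φ (x + b, θ)) + (φ (y + b, θ) - φ (y, θ))
          + -(φ (y, η y) - φ (y, θ)) := by
      have : x + b + (y - x) = y + b := by abel
      rw [this]
      simp only [graphTrace]
      ring
    rw [hdecomp]
    refine (enorm_add_five_sq_le _ _ _ _ _).trans ?_
    simp only [enorm_neg]
    gcongr
  calc ENNReal.ofReal l * ‖graphTrace η φ x - graphTrace η φ y‖ₑ ^ 2
      = ∫⁻ _ in S, ‖graphTrace η φ x - graphTrace η φ y‖ₑ ^ 2 := by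
        rw [setLIntegral_const, hvol, mul_comm]
    _ ≤ ∫⁻ θ in S, 5 * (ENNReal.ofReal (2 * l) * Γ x + ‖φ (x + b, θ) - φ (x, θ)‖ₑ ^ 2
        + ‖φ (x + b + (y - x), θ) - φ (x + b, θ)‖ₑ ^ 2 + ‖φ (y + b, θ) - φ (y, θ)‖ₑ ^ 2
        + ENNReal.ofReal (3 * l) * Γ y) := setLIntegral_mono' hSm hpt
    _ = 5 * (ENNReal.ofReal l * (ENNReal.ofReal (2 * l) * Γ x)
        + (∫⁻ θ in S, ‖φ (x + b, θ) - φ (x, θ)‖ₑ ^ 2)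
        + (∫⁻ θ in S, ‖φ (x + b + (y - x), θ) - φ (x + b, θ)‖ₑ ^ 2)
        + (∫⁻ θ in S, ‖φ (y + b, θ) - φ (y, θ)‖ₑ ^ 2)
        + ENNReal.ofReal l * (ENNReal.ofReal (3 * l) * Γ y)) := by
      rw [lintegral_const_mul' _ _ (by simp), lintegral_add_right _ measurable_const,
        lintegral_add_right _ (hmeas _ _), lintegral_add_right _ (hmeas _ _),
        lintegral_add_right _ (hmeas _ _), setLIntegral_const, setLIntegral_const, hvol,
        mul_comm _ (ENNReal.ofReal l), mul_comm _ (ENNReal.ofReal l)]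
    _ ≤ _ := by
      gcongr
      · refine lintegral_enorm_horizontal_sub_sq_le hΩ hφ hSm fun θ hθ σ hσ => ?_
        exact ⟨(h1 σ hσ).1, by simp only; linarith [hθ.1], hθ.2.trans_le (h1 σ hσ).2⟩
      · refine lintegral_enorm_horizontal_sub_sq_le hΩ hφ hSm fun θ hθ σ hσ => ?_
        exact ⟨(h2 σ hσ).1, by simp only; linarith [hθ.1], hθ.2.trans_le (h2 σ hσ).2⟩
      · refine lintegral_enorm_horizontal_sub_sq_le hΩ hφ hSm fun θ hθ σ hσ => ?_
        exact ⟨(h3 σ hσ).1, by simp only; linarith [hθ.1], hθ.2.trans_le (h3 σ hσ).2⟩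

/-- Sum of the slice integrals that control the increment of the trace from `x` to `x + h`. -/
noncomputable def incrementControl (Γ : 𝔼 → ℝ≥0∞) (v x h : 𝔼) : ℝ≥0∞ :=
  Γ x + segmentAverage Γ x ((2 * ‖h‖) • v) + segmentAverage Γ (x + (2 * ‖h‖) • v) h
    + segmentAverage Γ (x + h) ((2 * ‖h‖) • v) + Γ (x + h)

/-- With b = 2r v the points x + σb and y + σb are centres of cone balls, and the middle leg x + b +
σ(y − x) stays in the ball of radius 2r about x + b. The whole path is within Mr of x, where η
oscillates by at most l = c r^α. -/
theorem enorm_graphTrace_sub_sq_le {ω : Set 𝔼} {η : 𝔼 → ℝ}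
    (hΩ : MeasurableSet (subgraphDomain ω η)) {H α : ℝ≥0} (hα1 : α < 1)
    (hη : HolderOnWith H α η (closure ω)) {φ : 𝔼 × ℝ → ℝ} (hφ : ContDiff ℝ 1 φ) {x y v : 𝔼}
    (hx : x ∈ ω) (hy : y ∈ ω) (hxy : x ≠ y) {ρ c M : ℝ} (hc : 0 < c) (hM : 2 * ‖v‖ + 1 ≤ M)
    (hcM : H * M ^ (α : ℝ) ≤ c) (hr1 : ‖y - x‖ ≤ 1) (hrρ : 2 * ‖y - x‖ < ρ)
    (hrη : 2 * (c * ‖y - x‖ ^ (α : ℝ)) ≤ η x)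
    (hvx : ∀ ε, 0 < ε → ε < ρ → ball (x + ε • v) ε ⊆ ω)
    (hvy : ∀ ε, 0 < ε → ε < ρ → ball (y + ε • v) ε ⊆ ω) :
    ‖graphTrace η φ x - graphTrace η φ y‖ₑ ^ 2
      ≤ ENNReal.ofReal (15 * c + 5 * (M ^ 2 / c)) * ENNReal.ofReal (‖y - x‖ ^ (α : ℝ))
        * incrementControl (sliceIntegral (subgraphDomain ω η) fun z => ‖prodGradient φ z‖ₑ ^ 2)
          v x (y - x) := by
  set Γ := sliceIntegral (subgraphDomain ω η) fun z => ‖prodGradient φ z‖ₑ ^ 2 with hΓ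
  set r := ‖y - x‖ with hr
  have hr0 : 0 < r := norm_pos_iff.2 (sub_ne_zero.2 hxy.symm)
  set b : 𝔼 := (2 * r) • v with hb
  set l := c * r ^ (α : ℝ) with hl
  clear_value l
  have hra : 0 < r ^ (α : ℝ) := Real.rpow_pos_of_pos hr0 _
  have hl0 : 0 < l := by rw [hl]; positivity
  have hM1 : 1 ≤ M := by linarith [norm_nonneg v]
  have hbr : ‖b‖ + r ≤ M * r := by
    rw [hb, norm_smul, Real.norm_of_nonneg (by positivity)]
    nlinarith
  have hosc : ∀ w ∈ ω, ‖w - x‖ ≤ M * r → |η w - η x| ≤ l := by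
    intro w hw hwx
    have h := hη.dist_le_of_le (subset_closure hw) (subset_closure hx)
      (by rwa [dist_eq_norm] : dist w x ≤ M * r)
    rw [Real.dist_eq, Real.mul_rpow (by positivity) hr0.le, ← mul_assoc] at h
    exact h.trans (by rw [hl]; gcongr)
  have key : ∀ w ∈ ω, ‖w - x‖ ≤ ‖b‖ + r → w ∈ ω ∧ η x - l ≤ η w := fun w hw hwx =>
    ⟨hw, by linarith [(abs_le.1 (hosc w hw (hwx.trans hbr))).1]⟩
  have hseg : ∀ u : 𝔼, (∀ ε, 0 < ε → ε < ρ → ball (u + ε • v) ε ⊆ ω) → ∀ σ ∈ Ioo (0 : ℝ) 1,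
      u + σ • b ∈ ω := by
    intro u hu σ hσ
    rw [hb, smul_smul]
    have h0 : 0 < σ * (2 * r) := mul_pos hσ.1 (by positivity)
    exact hu _ h0 (by nlinarith [hσ.2]) (mem_ball_self h0)
  have hσb : ∀ σ ∈ Ioo (0 : ℝ) 1, ∀ a : 𝔼, ‖σ • a‖ ≤ ‖a‖ := by
    intro σ hσ a
    rw [norm_smul, Real.norm_of_nonneg hσ.1.le]
    nlinarith [hσ.2, norm_nonneg a]
  have h1 : ∀ σ ∈ Ioo (0 : ℝ) 1, x + σ • b ∈ ω ∧ η x - l ≤ η (x + σ • b) := fun σ hσ =>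
    key _ (hseg x hvx σ hσ) (by rw [add_sub_cancel_left]; linarith [hσb σ hσ b])
  have h2 : ∀ σ ∈ Ioo (0 : ℝ) 1,
      x + b + σ • (y - x) ∈ ω ∧ η x - l ≤ η (x + b + σ • (y - x)) := fun σ hσ => by
    refine key _ (hvx (2 * r) (by positivity) hrρ ?_) ?_
    · rw [mem_ball, dist_eq_norm, add_sub_cancel_left]
      linarith [hσb σ hσ (y - x)]
    · rw [add_assoc, add_sub_cancel_left]
      exact (norm_add_le _ _).trans (by linarith [hσb σ hσ (y - x)])
  have h3 : ∀ σ ∈ Ioo (0 : ℝ) 1, y + σ • b ∈ ω ∧ η x - l ≤ η (y + σ • b) := fun σ hσ => by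
    refine key _ (hseg y hvy σ hσ) ?_
    rw [show y + σ • b - x = σ • b + (y - x) by abel]
    exact (norm_add_le _ _).trans (by linarith [hσb σ hσ b])
  have hmain := ofReal_mul_enorm_graphTrace_sub_sq_le hΩ hφ hx hy hrη
    (hosc y hy (by linarith [norm_nonneg b])) h1 h2 h3
  rw [← hΓ] at hmain
  set D := ‖graphTrace η φ x - graphTrace η φ y‖ₑ ^ 2 with hD
  set Mr := ENNReal.ofReal ((M * r) ^ 2) with hMr
  have hnb : ‖b‖ₑ ^ 2 ≤ Mr := by
    rw [← ofReal_norm, ← ENNReal.ofReal_pow (norm_nonneg _)]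
    exact ENNReal.ofReal_le_ofReal (pow_le_pow_left₀ (norm_nonneg _) (by linarith) 2)
  have hnr : ‖y - x‖ₑ ^ 2 ≤ Mr := by
    rw [← ofReal_norm, ← ENNReal.ofReal_pow (norm_nonneg _)]
    exact ENNReal.ofReal_le_ofReal (pow_le_pow_left₀ (norm_nonneg _) (by nlinarith) 2)
  have hy' : Γ y = Γ (x + (y - x)) := by rw [add_sub_cancel]
  have hys : segmentAverage Γ y b = segmentAverage Γ (x + (y - x)) b := by rw [add_sub_cancel]
  set P := incrementControl Γ v x (y - x) with hP
  have hPd : P = Γ x + segmentAverage Γ x b + segmentAverage Γ (x + b) (y - x)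
    + segmentAverage Γ y b + Γ y := by
    rw [hP, incrementControl, ← hr, ← hb, ← hy', ← hys]
  -- Division by l leaves 15l + 5M²r²/l, that is 15c r^α + 5(M²/c) r^(2−α). The second power is at
  -- most r^α because r ≤ 1 and α < 1.
  have hK : 5 * (3 * l * l + (M * r) ^ 2) ≤ l * ((15 * c + 5 * (M ^ 2 / c)) * r ^ (α : ℝ)) := by
    have hrr : r ^ 2 ≤ r ^ (α : ℝ) * r ^ (α : ℝ) := by
      rw [← Real.rpow_add hr0, ← Real.rpow_natCast]
      refine Real.rpow_le_rpow_of_exponent_ge hr0 hr1 ?_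
      have : (α : ℝ) < 1 := by exact_mod_cast hα1
      push_cast; linarith
    have : l * ((15 * c + 5 * (M ^ 2 / c)) * r ^ (α : ℝ))
        = 15 * l * l + 5 * M ^ 2 * (r ^ (α : ℝ) * r ^ (α : ℝ)) := by
      rw [hl]; field_simp
    rw [this]
    nlinarith [mul_le_mul_of_nonneg_left hrr (sq_nonneg M)]
  have hle : ENNReal.ofReal l * D ≤ ENNReal.ofReal l *
      (ENNReal.ofReal ((15 * c + 5 * (M ^ 2 / c)) * r ^ (α : ℝ)) * P) := by
    refine hmain.trans ?_
    rw [← mul_assoc (ENNReal.ofReal l) _ P, ← ENNReal.ofReal_mul hl0.le]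
    refine le_trans ?_ (mul_le_mul_left (ENNReal.ofReal_le_ofReal hK) P)
    rw [ENNReal.ofReal_mul (p := 5) (by norm_num), ENNReal.ofReal_ofNat, mul_assoc,
      ENNReal.ofReal_add (by positivity) (by positivity), ← hMr, hPd]
    gcongr
    rw [← mul_assoc, ← mul_assoc, ← ENNReal.ofReal_mul hl0.le, ← ENNReal.ofReal_mul hl0.le]
    set A := ENNReal.ofReal (3 * l * l)
    have hA1 : ENNReal.ofReal (l * (2 * l)) ≤ A + Mr :=
      (ENNReal.ofReal_le_ofReal (by nlinarith)).trans le_self_add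
    have hA2 : ENNReal.ofReal (l * (3 * l)) ≤ A + Mr :=
      (ENNReal.ofReal_le_ofReal (by nlinarith)).trans le_self_add
    have hA3 := hnb.trans (le_add_self : Mr ≤ A + Mr)
    have hA4 := hnr.trans (le_add_self : Mr ≤ A + Mr)
    rw [mul_add, mul_add, mul_add, mul_add]
    gcongr
  rw [ENNReal.ofReal_mul (by positivity)] at hle
  exact (ENNReal.mul_le_mul_iff_right (by simpa using hl0) ENNReal.ofReal_ne_top).1 hle

/-! ### Integration of the increment bound -/

theorem measurable_segmentAverage {Γ : 𝔼 → ℝ≥0∞} (hΓ : Measurable Γ) :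
    Measurable fun p : 𝔼 × 𝔼 => segmentAverage Γ p.1 p.2 := by
  have h : Measurable fun q : (𝔼 × 𝔼) × ℝ => Γ (q.1.1 + q.2 • q.1.2) := hΓ.comp (by fun_prop)
  exact h.lintegral_prod_right'

/-- For each σ the integrand is a translate of Γ, and σ runs over an interval of length 1. -/
theorem lintegral_segmentAverage {Γ : 𝔼 → ℝ≥0∞} (hΓ : Measurable Γ) (a c : 𝔼) :
    ∫⁻ x, segmentAverage Γ (x + c) a = ∫⁻ x, Γ x := by
  simp only [segmentAverage]
  have hm : Measurable fun q : 𝔼 × ℝ => Γ (q.1 + c + q.2 • a) := hΓ.comp (by fun_prop)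
  rw [lintegral_lintegral_swap hm.aemeasurable]
  simp only [add_assoc]
  simp_rw [lintegral_add_right_eq_self Γ]
  simp

theorem measurable_incrementControl {Γ : 𝔼 → ℝ≥0∞} (hΓ : Measurable Γ) (v : 𝔼) :
    Measurable fun p : 𝔼 × 𝔼 => incrementControl Γ v p.1 p.2 := by
  have hs := measurable_segmentAverage hΓ
  refine ((((hΓ.comp measurable_fst).add ?_).add ?_).add ?_).add (hΓ.comp (by fun_prop))
  · exact hs.comp (f := fun p : 𝔼 × 𝔼 => (p.1, (2 * ‖p.2‖) • v)) (by fun_prop)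
  · exact hs.comp (f := fun p : 𝔼 × 𝔼 => (p.1 + (2 * ‖p.2‖) • v, p.2)) (by fun_prop)
  · exact hs.comp (f := fun p : 𝔼 × 𝔼 => (p.1 + p.2, (2 * ‖p.2‖) • v)) (by fun_prop)

theorem lintegral_incrementControl {Γ : 𝔼 → ℝ≥0∞} (hΓ : Measurable Γ) (v h : 𝔼) :
    ∫⁻ x, incrementControl Γ v x h = 5 * ∫⁻ x, Γ x := by
  have hs := measurable_segmentAverage hΓ
  have h1 : Measurable fun x : 𝔼 => segmentAverage Γ x ((2 * ‖h‖) • v) :=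
    hs.comp (f := fun x : 𝔼 => (x, (2 * ‖h‖) • v)) (by fun_prop)
  have h2 : Measurable fun x : 𝔼 => segmentAverage Γ (x + (2 * ‖h‖) • v) h :=
    hs.comp (f := fun x : 𝔼 => (x + (2 * ‖h‖) • v, h)) (by fun_prop)
  have h3 : Measurable fun x : 𝔼 => segmentAverage Γ (x + h) ((2 * ‖h‖) • v) :=
    hs.comp (f := fun x : 𝔼 => (x + h, (2 * ‖h‖) • v)) (by fun_prop)
  have e1 := lintegral_segmentAverage hΓ ((2 * ‖h‖) • v) 0
  simp only [add_zero] at e1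
  simp only [incrementControl]
  have h4 : Measurable fun x : 𝔼 => Γ (x + h) := hΓ.comp (by fun_prop)
  rw [lintegral_add_right _ h4, lintegral_add_right _ h3, lintegral_add_right _ h2,
    lintegral_add_right _ h1, e1, lintegral_segmentAverage hΓ,
    lintegral_segmentAverage hΓ, lintegral_add_right_eq_self Γ]
  ring

/-- The substitution h = y − x and Tonelli separate the kernel from Γ, because the x-integral of
`incrementControl` does not depend on h. -/
theorem lintegral_kernel_mul_incrementControl {Γ k : 𝔼 → ℝ≥0∞} (hΓ : Measurable Γ)
    (hk : Measurable k) (v : 𝔼) :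
    ∫⁻ x, ∫⁻ y, k (y - x) * incrementControl Γ v x (y - x)
      = (∫⁻ h, k h) * (5 * ∫⁻ x, Γ x) := by
  have hm := measurable_incrementControl hΓ v
  have h1 : ∀ x : 𝔼, ∫⁻ y, k (y - x) * incrementControl Γ v x (y - x)
      = ∫⁻ h, k h * incrementControl Γ v x h := fun x =>
    lintegral_sub_right_eq_self (fun h => k h * incrementControl Γ v x h) x
  simp_rw [h1]
  rw [lintegral_lintegral_swap
    (Measurable.aemeasurable ((hk.comp measurable_snd).mul hm))]
  have h2 : ∀ h : 𝔼, ∫⁻ x, k h * incrementControl Γ v x h = k h * (5 * ∫⁻ x, Γ x) := fun h => by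
    have hmh : Measurable fun x => incrementControl Γ v x h :=
      hm.comp (f := fun x : 𝔼 => (x, h)) (by fun_prop)
    rw [lintegral_const_mul _ hmh,
      lintegral_incrementControl hΓ]
  simp_rw [h2]
  rw [lintegral_mul_const _ hk]

/-! ### The trace inequality for `C¹` functions -/

theorem ofReal_mul_enorm_graphTrace_sq_le {ω : Set 𝔼} {η : 𝔼 → ℝ} {φ : 𝔼 × ℝ → ℝ}
    (hφ : ContDiff ℝ 1 φ) {x : 𝔼} (hx : x ∈ ω) {m M : ℝ} (hm : m ≤ η x) (hM : η x ≤ M) :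
    ENNReal.ofReal m * ‖graphTrace η φ x‖ₑ ^ 2
      ≤ 2 * (sliceIntegral (subgraphDomain ω η) (fun z => ‖φ z‖ₑ ^ 2) x + ENNReal.ofReal m *
        (ENNReal.ofReal M
          * sliceIntegral (subgraphDomain ω η) (fun z => ‖prodGradient φ z‖ₑ ^ 2) x)) := by
  set Γ := sliceIntegral (subgraphDomain ω η) fun z => ‖prodGradient φ z‖ₑ ^ 2 with hΓ
  have hpt : ∀ θ ∈ Ioo 0 m, ‖graphTrace η φ x‖ₑ ^ 2
      ≤ 2 * ((subgraphDomain ω η).indicator (fun z => ‖φ z‖ₑ ^ 2) (x, θ)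
        + ENNReal.ofReal M * Γ x) := by
    intro θ hθ
    have hmem : (x, θ) ∈ subgraphDomain ω η := ⟨hx, hθ.1, hθ.2.trans_le hm⟩
    have hA : ‖φ (x, η x) - φ (x, θ)‖ₑ ^ 2 ≤ ENNReal.ofReal M * Γ x :=
      (enorm_vertical_sub_sq_le hφ (hθ.2.le.trans hm) fun t ht =>
        (⟨hx, hθ.1.trans ht.1, ht.2⟩ : (x, t) ∈ subgraphDomain ω η)).trans
        (by gcongr; linarith [hθ.1])
    rw [show graphTrace η φ x = φ (x, θ) + (φ (x, η x) - φ (x, θ)) by simp [graphTrace],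
      indicator_of_mem hmem]
    refine (enorm_add_sq_le _ _).trans ?_
    gcongr
  calc ENNReal.ofReal m * ‖graphTrace η φ x‖ₑ ^ 2
      = ∫⁻ _ in Ioo 0 m, ‖graphTrace η φ x‖ₑ ^ 2 := by
        rw [setLIntegral_const, Real.volume_Ioo, sub_zero, mul_comm]
    _ ≤ ∫⁻ θ in Ioo 0 m, 2 * ((subgraphDomain ω η).indicator (fun z => ‖φ z‖ₑ ^ 2) (x, θ)
        + ENNReal.ofReal M * Γ x) := setLIntegral_mono' measurableSet_Ioo hpt
    _ = 2 * ((∫⁻ θ in Ioo 0 m, (subgraphDomain ω η).indicator (fun z => ‖φ z‖ₑ ^ 2) (x, θ))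
        + ENNReal.ofReal m * (ENNReal.ofReal M * Γ x)) := by
      rw [lintegral_const_mul' _ _ (by simp), lintegral_add_right _ measurable_const,
        setLIntegral_const, Real.volume_Ioo, sub_zero, mul_comm _ (ENNReal.ofReal m)]
    _ ≤ _ := by
      gcongr
      exact setLIntegral_le_lintegral _ _

/-- The trace at x is a value at height θ ∈ (0, m) plus a vertical increment of length at most M.
The average over θ gives 2/m for the L² part and 2M for the gradient part. -/
theorem exists_lintegral_graphTrace_sq_le {ω : Set 𝔼} {η : 𝔼 → ℝ} (hω : MeasurableSet ω)
    (hΩ : MeasurableSet (subgraphDomain ω η)) {m M : ℝ} (hm0 : 0 < m) (hm : ∀ x ∈ ω, m ≤ η x)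
    (hM : ∀ x ∈ ω, η x ≤ M) :
    ∃ C : ℝ≥0, ∀ φ : 𝔼 × ℝ → ℝ, ContDiff ℝ 1 φ → ∫⁻ x in ω, ‖graphTrace η φ x‖ₑ ^ 2
      ≤ C * ((∫⁻ z in subgraphDomain ω η, ‖φ z‖ₑ ^ 2)
        + ∫⁻ z in subgraphDomain ω η, ‖prodGradient φ z‖ₑ ^ 2) := by
  refine ⟨(2 / m + 2 * M).toNNReal, fun φ hφ => ?_⟩
  have hm0' : ENNReal.ofReal m ≠ 0 := by simpa using hm0
  have hF : Measurable fun z => ‖φ z‖ₑ ^ 2 := hφ.continuous.enorm.measurable.pow_const 2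
  have hG : Measurable fun z => ‖prodGradient φ z‖ₑ ^ 2 :=
    (continuous_prodGradient hφ).enorm.measurable.pow_const 2
  rcases ω.eq_empty_or_nonempty with rfl | ⟨x₀, hx₀⟩
  · simp
  have hM0 : 0 < M := hm0.trans_le ((hm x₀ hx₀).trans (hM x₀ hx₀))
  rw [← ENNReal.mul_le_mul_iff_right hm0' ENNReal.ofReal_ne_top]
  calc ENNReal.ofReal m * ∫⁻ x in ω, ‖graphTrace η φ x‖ₑ ^ 2
      = ∫⁻ x in ω, ENNReal.ofReal m * ‖graphTrace η φ x‖ₑ ^ 2 := by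
        rw [lintegral_const_mul' _ _ ENNReal.ofReal_ne_top]
    _ ≤ ∫⁻ x in ω, 2 * (sliceIntegral (subgraphDomain ω η) (fun z => ‖φ z‖ₑ ^ 2) x
        + ENNReal.ofReal m * (ENNReal.ofReal M
          * sliceIntegral (subgraphDomain ω η) (fun z => ‖prodGradient φ z‖ₑ ^ 2) x)) :=
        setLIntegral_mono' hω fun x hx => ofReal_mul_enorm_graphTrace_sq_le hφ hx (hm x hx) (hM x hx)
    _ ≤ ∫⁻ x, 2 * (sliceIntegral (subgraphDomain ω η) (fun z => ‖φ z‖ₑ ^ 2) x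
        + ENNReal.ofReal m * (ENNReal.ofReal M
          * sliceIntegral (subgraphDomain ω η) (fun z => ‖prodGradient φ z‖ₑ ^ 2) x)) :=
        setLIntegral_le_lintegral _ _
    _ = 2 * ((∫⁻ z in subgraphDomain ω η, ‖φ z‖ₑ ^ 2) + ENNReal.ofReal m * (ENNReal.ofReal M
        * ∫⁻ z in subgraphDomain ω η, ‖prodGradient φ z‖ₑ ^ 2)) := by
      rw [lintegral_const_mul' _ _ (by simp), lintegral_add_left (measurable_sliceIntegral hΩ hF),
        lintegral_const_mul' _ _ (by simp), lintegral_const_mul' _ _ (by simp),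
        lintegral_sliceIntegral hΩ hF, lintegral_sliceIntegral hΩ hG]
    _ ≤ _ := by
      generalize ∫⁻ z in subgraphDomain ω η, ‖φ z‖ₑ ^ 2 = A
      generalize ∫⁻ z in subgraphDomain ω η, ‖prodGradient φ z‖ₑ ^ 2 = B
      rw [← ENNReal.ofReal, ← mul_assoc, ← ENNReal.ofReal_mul hm0.le, ← mul_assoc,
        ← ENNReal.ofReal_mul hm0.le, mul_add, mul_add, ← mul_assoc, ← ENNReal.ofReal_ofNat,
        ← ENNReal.ofReal_mul (by norm_num)]
      have : m * (2 / m + 2 * M) = 2 + 2 * (m * M) := by field_simp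
      rw [this]
      gcongr
      · exact le_add_of_nonneg_right (by positivity)
      · linarith

theorem enorm_slobodeckijQuotient_sq {s : ℝ} (hs : s ≠ 0) (u : 𝔼 → ℝ) {x y : 𝔼} (hxy : x ≠ y) :
    ‖slobodeckijQuotient s u (x, y)‖ₑ ^ 2
      = ‖u x - u y‖ₑ ^ 2 * ENNReal.ofReal (‖y - x‖ ^ (-(d + 2 * s) : ℝ)) := by
  have hr : 0 < ‖y - x‖ := norm_pos_iff.2 (sub_ne_zero.2 hxy.symm)
  rw [slobodeckijQuotient, if_neg hs, norm_sub_rev x y, enorm_sq_eq_ofReal, enorm_sq_eq_ofReal,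
    div_pow, div_eq_mul_inv, ENNReal.ofReal_mul (sq_nonneg _), Real.rpow_neg hr.le,
    ← Real.rpow_natCast (_ ^ _) 2, ← Real.rpow_mul hr.le]
  congr 5
  push_cast
  ring

/-- The trace inequality for functions that are `C¹` up to the boundary. -/
theorem exists_lintegral_slobodeckijQuotient_graphTrace_sq_le (hd : 1 ≤ d) {ω : Set 𝔼}
    (hω : IsLipschitzDomain ω) {α : ℝ≥0} (hα0 : 0 < α) (hα1 : α < 1) {η : 𝔼 → ℝ} {H : ℝ≥0}
    (hη : HolderOnWith H α η (closure ω)) {m M : ℝ} (hm0 : 0 < m) (hm : ∀ x ∈ ω, m ≤ η x)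
    (hM : ∀ x ∈ ω, η x ≤ M) {s : ℝ} (hs0 : 0 ≤ s) (hs : s < (α : ℝ) / 2) :
    ∃ C : ℝ≥0, ∀ φ : 𝔼 × ℝ → ℝ, ContDiff ℝ 1 φ →
      ∫⁻ p, ‖slobodeckijQuotient s (graphTrace η φ) p‖ₑ ^ 2
          ∂((volume.restrict ω).prod (volume.restrict ω))
        ≤ C * ((∫⁻ z in subgraphDomain ω η, ‖φ z‖ₑ ^ 2)
          + ∫⁻ z in subgraphDomain ω η, ‖prodGradient φ z‖ₑ ^ 2) := by
  rcases hs0.eq_or_lt with rfl | hs0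
  · exact ⟨0, fun φ _ => by simp [slobodeckijQuotient]⟩
  have hα0' : (0 : ℝ) < α := by exact_mod_cast hα0
  have hΩ : MeasurableSet (subgraphDomain ω η) := (isOpen_subgraphDomain hω.isOpen
    ((hη.continuousOn hα0).mono subset_closure)).measurableSet
  obtain ⟨C₀, hC₀⟩ := exists_lintegral_graphTrace_sq_le hω.isOpen.measurableSet hΩ hm0 hm hM
  obtain ⟨t, r, v, ρ, hρ, hcover, hcone⟩ := hω.exists_finite_cone_cover
  obtain ⟨N, hN⟩ : ∃ N : ℝ, ∀ p ∈ t, 2 * ‖v p‖ + 1 ≤ N := by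
    obtain ⟨N, hN⟩ := (t.finite_toSet.image fun p => 2 * ‖v p‖ + 1).bddAbove
    exact ⟨N, fun p hp => hN ⟨p, hp, rfl⟩⟩
  -- The added 1 keeps `c` positive even when the Hölder constant is 0, as the depth l = c r^α must
  -- be.
  obtain ⟨c, hc, hcN⟩ : ∃ c : ℝ, 0 < c ∧ H * N ^ (α : ℝ) ≤ c :=
    ⟨|H * N ^ (α : ℝ)| + 1, by positivity, (le_abs_self _).trans (by linarith)⟩
  -- Pairs closer than r₀ allow the detour: r₀ ≤ 1 to compare powers of r, 2r₀ < ρ for the cone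
  -- balls, and the last condition so that depth 2l stays above the bottom of Ω_η.
  obtain ⟨r₀, hr₀, hr₁, hrρ, hrm⟩ : ∃ r₀ : ℝ, 0 < r₀ ∧ r₀ ≤ 1 ∧ 2 * r₀ < ρ ∧
      2 * (c * r₀ ^ (α : ℝ)) < m := by
    have h1 : Tendsto (fun r₀ : ℝ => 2 * (c * r₀ ^ (α : ℝ))) (𝓝 0) (𝓝 (2 * (c * 0 ^ (α : ℝ)))) :=
      (((Real.continuous_rpow_const hα0'.le).tendsto 0).const_mul c).const_mul 2
    rw [Real.zero_rpow hα0'.ne', mul_zero, mul_zero] at h1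
    have h2 : Tendsto (fun r₀ : ℝ => 2 * r₀) (𝓝 0) (𝓝 (2 * 0)) := (continuous_const_mul 2).tendsto 0
    rw [mul_zero] at h2
    have h3 := (eventually_le_nhds (zero_lt_one' ℝ)).and
      ((h2.eventually (eventually_lt_nhds hρ)).and (h1.eventually (eventually_lt_nhds hm0)))
    exact ((eventually_mem_nhdsWithin (a := (0 : ℝ)) (s := Ioi 0)).and
      (eventually_nhdsWithin_of_eventually_nhds h3)).exists
  -- The gain r^α of the increment bound times the Gagliardo weight r^(−d−2s).
  set k : 𝔼 → ℝ≥0∞ := (ball 0 r₀).indicator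
    fun h => ENNReal.ofReal (‖h‖ ^ (α - 2 * s - d : ℝ)) with hk
  have hkm : Measurable k :=
    (ENNReal.measurable_ofReal.comp (measurable_norm.pow_const _)).indicator measurableSet_ball
  have hkfin : ∫⁻ h, k h ≠ ∞ := by
    have hInt : IntegrableOn (fun h : 𝔼 => ‖h‖ ^ (α - 2 * s - d : ℝ)) (ball 0 r₀) := by
      refine integrableOn_ball_of_norm_le_rpow (C := 1) (α := d - (α - 2 * s)) (by simpa using hd)
        (by rw [finrank_euclideanSpace_fin]; linarith) (Eventually.of_forall fun h => ?_)
        (measurable_norm.pow_const _).aestronglyMeasurable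
      rw [Real.norm_of_nonneg (by positivity), one_mul, neg_sub]
    rw [hk, lintegral_indicator measurableSet_ball]
    exact hInt.lintegral_lt_top.ne
  set A : ℝ≥0∞ := 2 * ENNReal.ofReal (r₀ ^ (-(d + 2 * s) : ℝ)) with hA
  set B : ℝ≥0∞ := ENNReal.ofReal (15 * c + 5 * (N ^ 2 / c)) with hB
  have hVfin : volume ω ≠ ∞ := hω.isBounded.measure_lt_top.ne
  have hAfin : A ≠ ∞ := by simp [hA, ENNReal.mul_eq_top]
  have hBfin : B ≠ ∞ := ENNReal.ofReal_ne_top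
  set C : ℝ≥0∞ := 2 * (A * volume ω * C₀) + t.card * (B * ((∫⁻ h, k h) * 5)) with hC
  have hCfin : C ≠ ∞ := by
    rw [hC]
    finiteness
  refine ⟨C.toNNReal, fun φ hφ => ?_⟩
  rw [ENNReal.coe_toNNReal hCfin]
  set g := graphTrace η φ with hg
  set Γ := sliceIntegral (subgraphDomain ω η) fun z => ‖prodGradient φ z‖ₑ ^ 2 with hΓ
  have hGm : Measurable fun z => ‖prodGradient φ z‖ₑ ^ 2 :=
    (continuous_prodGradient hφ).enorm.measurable.pow_const 2
  have hΓm : Measurable Γ := measurable_sliceIntegral hΩ hGm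
  have hΓi : ∫⁻ x, Γ x = ∫⁻ z in subgraphDomain ω η, ‖prodGradient φ z‖ₑ ^ 2 :=
    lintegral_sliceIntegral hΩ hGm
  have hpt : ∀ x ∈ ω, ∀ y ∈ ω, ‖slobodeckijQuotient s g (x, y)‖ₑ ^ 2
      ≤ A * ‖g x‖ₑ ^ 2 + A * ‖g y‖ₑ ^ 2
        + ∑ p ∈ t, B * (k (y - x) * incrementControl Γ (v p) x (y - x)) := by
    intro x hx y hy
    by_cases hxy : x = y
    · rw [slobodeckijQuotient]
      simp [hxy, hs0.ne']
    rw [enorm_slobodeckijQuotient_sq hs0.ne' g hxy]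
    have hr : 0 < ‖y - x‖ := norm_pos_iff.2 (sub_ne_zero.2 (Ne.symm hxy))
    -- Far pairs: the weight is at most r₀^(−d−2s), and the L² norm of the trace suffices. Near
    -- pairs use the detour.
    by_cases hfar : r₀ ≤ ‖y - x‖
    · refine le_trans ?_ le_self_add
      rw [← mul_add, sub_eq_add_neg]
      refine (mul_le_mul' (enorm_add_sq_le _ _) (ENNReal.ofReal_le_ofReal
        (Real.rpow_le_rpow_of_nonpos hr₀ hfar (by
          have : (0 : ℝ) ≤ d := Nat.cast_nonneg d
          linarith)))).trans_eq ?_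
      rw [enorm_neg, hA]
      ring
    · push Not at hfar
      refine le_trans ?_ le_add_self
      obtain ⟨p, hp, hxp⟩ : ∃ p ∈ t, x ∈ ball p (r p) := by
        simpa using hcover (subset_closure hx)
      rw [mem_ball] at hxp
      refine le_trans ?_ (Finset.single_le_sum
        (f := fun p => B * (k (y - x) * incrementControl Γ (v p) x (y - x)))
        (fun _ _ => zero_le) hp)
      have hyp : dist y p < r p + ρ := by
        have := dist_triangle y x p
        rw [dist_eq_norm y x] at this
        linarith
      have hincr := enorm_graphTrace_sub_sq_le hΩ hα1 hη hφ hx hy hxy hc (hN p hp) hcN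
        (hfar.le.trans hr₁) (by linarith) (by
          refine le_trans ?_ (hm x hx)
          refine le_trans ?_ hrm.le
          gcongr) (hcone p hp x hx (by linarith)) (hcone p hp y hy hyp)
      refine (mul_le_mul_left hincr _).trans_eq ?_
      have hkv : k (y - x) = ENNReal.ofReal (‖y - x‖ ^ (α : ℝ))
          * ENNReal.ofReal (‖y - x‖ ^ (-(d + 2 * s) : ℝ)) := by
        rw [hk, indicator_of_mem (by simpa using hfar), ← ENNReal.ofReal_mul (by positivity),
          ← Real.rpow_add hr]
        congr 2
        ring
      rw [hkv]
      ring
  have hIC : ∀ p x, Measurable fun y => k (y - x) * incrementControl Γ (v p) x (y - x) :=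
    fun p x => (hkm.comp (measurable_id.sub_const x)).mul
      ((measurable_incrementControl hΓm (v p)).comp (f := fun y : 𝔼 => (x, y - x)) (by fun_prop))
  have hIC2 : ∀ p, Measurable fun x => ∫⁻ y, k (y - x) * incrementControl Γ (v p) x (y - x) :=
    fun p => Measurable.lintegral_prod_right'
      (f := fun q : 𝔼 × 𝔼 => k (q.2 - q.1) * incrementControl Γ (v p) q.1 (q.2 - q.1))
      ((hkm.comp (measurable_snd.sub measurable_fst)).mul
        ((measurable_incrementControl hΓm (v p)).comp (f := fun q : 𝔼 × 𝔼 => (q.1, q.2 - q.1))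
          (by fun_prop)))
  set I := ∫⁻ x in ω, ‖g x‖ₑ ^ 2 with hI
  -- `lintegral_prod_le` needs no measurability of the quotient, since only an upper bound by the
  -- iterated integral is used.
  calc ∫⁻ p, ‖slobodeckijQuotient s g p‖ₑ ^ 2 ∂((volume.restrict ω).prod (volume.restrict ω))
      ≤ ∫⁻ x in ω, ∫⁻ y in ω, ‖slobodeckijQuotient s g (x, y)‖ₑ ^ 2 := lintegral_prod_le _
    _ ≤ ∫⁻ x in ω, ∫⁻ y in ω, (A * ‖g x‖ₑ ^ 2 + A * ‖g y‖ₑ ^ 2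
        + ∑ p ∈ t, B * (k (y - x) * incrementControl Γ (v p) x (y - x))) :=
        setLIntegral_mono' hω.isOpen.measurableSet fun x hx =>
          setLIntegral_mono' hω.isOpen.measurableSet fun y hy => hpt x hx y hy
    _ ≤ ∫⁻ x in ω, (A * volume ω * ‖g x‖ₑ ^ 2 + A * I
        + ∑ p ∈ t, B * ∫⁻ y, k (y - x) * incrementControl Γ (v p) x (y - x)) := by
      refine lintegral_mono fun x => ?_
      rw [lintegral_add_right _ (Finset.measurable_fun_sum _ fun p _ => (hIC p x).const_mul B),
        lintegral_add_left measurable_const, setLIntegral_const, lintegral_const_mul' _ _ hAfin,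
        lintegral_finsetSum _ fun p _ => (hIC p x).const_mul B, mul_right_comm]
      gcongr with p hp
      rw [lintegral_const_mul' _ _ hBfin]
      gcongr
      exact Measure.restrict_le_self
    _ ≤ A * volume ω * I + A * I * volume ω
        + ∑ p ∈ t, B * ((∫⁻ h, k h) * (5 * ∫⁻ x, Γ x)) := by
      rw [lintegral_add_right _ (Finset.measurable_fun_sum _ fun p _ => (hIC2 p).const_mul B),
        lintegral_add_right _ measurable_const, setLIntegral_const,
        lintegral_const_mul' _ _ (by finiteness),
        lintegral_finsetSum _ fun p _ => (hIC2 p).const_mul B]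
      gcongr with p hp
      rw [lintegral_const_mul' _ _ hBfin, ← lintegral_kernel_mul_incrementControl hΓm hkm (v p)]
      gcongr
      exact Measure.restrict_le_self
    _ ≤ _ := by
      have hI0 := hC₀ φ hφ
      rw [← hg, ← hI] at hI0
      rw [hΓi, Finset.sum_const, nsmul_eq_mul, hC]
      revert hI0
      generalize ∫⁻ z in subgraphDomain ω η, ‖φ z‖ₑ ^ 2 = X
      generalize ∫⁻ z in subgraphDomain ω η, ‖prodGradient φ z‖ₑ ^ 2 = Y
      intro hI0
      calc _ = 2 * (A * volume ω * I) + t.card * (B * ((∫⁻ h, k h) * 5)) * Y := by ring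
        _ ≤ 2 * (A * volume ω * (C₀ * (X + Y))) + t.card * (B * ((∫⁻ h, k h) * 5)) * (X + Y) := by
          gcongr
          exact le_add_self
        _ = _ := by ring

/-! ### Affine shifts and mollification in L² -/

instance isAddHaarMeasure_volume_prod_real : (volume : Measure (𝔼 × ℝ)).IsAddHaarMeasure :=
  inferInstanceAs ((volume : Measure 𝔼).prod (volume : Measure ℝ)).IsAddHaarMeasure

theorem eLpNorm_two_sq {X F : Type*} [MeasurableSpace X] [NormedAddCommGroup F] (μ : Measure X)
    (f : X → F) : eLpNorm f 2 μ ^ 2 = ∫⁻ x, ‖f x‖ₑ ^ 2 ∂μ := by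
  have h := eLpNorm_nnreal_pow_eq_lintegral (f := f) (μ := μ) (p := 2) two_ne_zero
  simpa using h

/-- The map `(x, t) ↦ (x + b₁, c t + b₂)` of `ℝ^d × ℝ`. -/
def affineShift (c : ℝ) (b z : 𝔼 × ℝ) : 𝔼 × ℝ := (z.1 + b.1, c * z.2 + b.2)

theorem affineShift_sub (c : ℝ) (b z y : 𝔼 × ℝ) :
    affineShift c b z - y = affineShift c (b - y) z := by
  ext <;> simp [affineShift] <;> ring

theorem measurable_affineShift (c : ℝ) (b : 𝔼 × ℝ) : Measurable (affineShift c b) := by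
  unfold affineShift
  fun_prop

theorem map_affineShift {c : ℝ} (hc : c ≠ 0) (b : 𝔼 × ℝ) :
    Measure.map (affineShift c b) volume = ENNReal.ofReal |c⁻¹| • volume := by
  have h1 : Measure.map (fun t : ℝ => c * t + b.2) volume = ENNReal.ofReal |c⁻¹| • volume := by
    have : (fun t : ℝ => c * t + b.2) = (fun t => t + b.2) ∘ fun t => c * t := rfl
    rw [this, ← Measure.map_map (by fun_prop) (by fun_prop), Real.map_volume_mul_left hc,
      Measure.map_smul, map_add_right_eq_self]
  have h2 : affineShift c b = Prod.map (fun x => x + b.1) fun t => c * t + b.2 := rfl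
  rw [h2, Measure.volume_eq_prod, ← Measure.map_prod_map _ _ (by fun_prop) (by fun_prop), h1,
    map_add_right_eq_self, Measure.prod_smul_right]

section

variable {F : Type*} [NormedAddCommGroup F]

/-- The change of variables costs c^(−1/2), and c > 1/2. Uniformity in the shift is what transfers
continuity from compactly supported functions to L². -/
theorem eLpNorm_comp_affineShift_le {w : 𝔼 × ℝ → F} (hw : AEStronglyMeasurable w volume) {c : ℝ}
    (hc : |c - 1| < 1 / 2) (b : 𝔼 × ℝ) :
    eLpNorm (fun z => w (affineShift c b z)) 2 volume ≤ 2 * eLpNorm w 2 volume := by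
  have hc1 : 1 / 2 < c := by linarith [(abs_lt.1 hc).1]
  have hc0 : 0 < c := by linarith
  have hmap := map_affineShift hc0.ne' b
  have hw' : AEStronglyMeasurable w (Measure.map (affineShift c b) volume) := by
    rw [hmap]; exact hw.mono_ac (Measure.smul_absolutelyContinuous)
  have h := eLpNorm_map_measure (p := 2) hw' (measurable_affineShift c b).aemeasurable
  rw [hmap, eLpNorm_smul_measure_of_ne_top (by simp)] at h
  rw [show (fun z => w (affineShift c b z)) = w ∘ affineShift c b from rfl, ← h, smul_eq_mul]
  gcongr
  have h2 : ENNReal.ofReal |c⁻¹| ≤ 2 := by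
    rw [← ENNReal.ofReal_ofNat]
    refine ENNReal.ofReal_le_ofReal ?_
    rw [abs_of_pos (inv_pos.2 hc0)]
    exact inv_le_of_inv_le₀ (by norm_num) (by linarith)
  calc ENNReal.ofReal |c⁻¹| ^ (1 / (2 : ℝ≥0∞)).toReal ≤ 2 ^ (1 / (2 : ℝ≥0∞)).toReal := by gcongr
    _ ≤ 2 ^ (1 : ℝ) := by
      refine ENNReal.rpow_le_rpow_of_exponent_le (by norm_num) ?_
      norm_num
    _ = 2 := by simp

/-- Uniform continuity of ψ, combined with a fixed ball that contains the supports of all the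
differences. -/
theorem exists_eLpNorm_comp_affineShift_sub_le_of_hasCompactSupport {ψ : 𝔼 × ℝ → F}
    (hψ : Continuous ψ) (hc : HasCompactSupport ψ) {κ : ℝ≥0∞} (hκ : κ ≠ 0) :
    ∃ r > 0, ∀ (c : ℝ) (b : 𝔼 × ℝ), |c - 1| < r → ‖b‖ < r →
      eLpNorm (fun z => ψ (affineShift c b z) - ψ z) 2 volume ≤ κ := by
  obtain ⟨R, hR0, hR⟩ : ∃ R : ℝ, 0 < R ∧ tsupport ψ ⊆ closedBall 0 R := by
    obtain ⟨R, hR⟩ := hc.isCompact.isBounded.subset_closedBall 0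
    exact ⟨max R 1, by positivity, hR.trans (closedBall_subset_closedBall (le_max_left _ _))⟩
  have hzero : ∀ z, R < ‖z‖ → ψ z = 0 := fun z hz =>
    image_eq_zero_of_notMem_tsupport fun h => by
      have := hR h
      rw [mem_closedBall_zero_iff] at this
      linarith
  set V := volume (closedBall (0 : 𝔼 × ℝ) (2 * R + 2)) with hV
  have hVfin : V ≠ ∞ := measure_closedBall_lt_top.ne
  obtain ⟨ε, hε, hεκ⟩ : ∃ ε : ℝ, 0 < ε ∧ V ^ (2 : ℝ≥0∞).toReal⁻¹ * ENNReal.ofReal ε ≤ κ := by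
    have h1 : Tendsto (fun ε : ℝ => V ^ (2 : ℝ≥0∞).toReal⁻¹ * ENNReal.ofReal ε) (𝓝 0)
        (𝓝 (V ^ (2 : ℝ≥0∞).toReal⁻¹ * ENNReal.ofReal 0)) :=
      ENNReal.Tendsto.const_mul (ENNReal.continuous_ofReal.tendsto 0)
        (Or.inr (ENNReal.rpow_ne_top_of_nonneg (by positivity) hVfin))
    rw [ENNReal.ofReal_zero, mul_zero] at h1
    exact ((eventually_mem_nhdsWithin (a := (0 : ℝ)) (s := Ioi 0)).and
      (eventually_nhdsWithin_of_eventually_nhds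
        (h1.eventually (eventually_le_nhds (pos_iff_ne_zero.2 hκ))))).exists
  obtain ⟨δ, hδ, hδε⟩ := Metric.uniformContinuous_iff.1 (hc.uniformContinuous_of_continuous hψ) ε hε
  -- On the ball of radius 2R + 2 a point moves by at most |c − 1|(2R + 2) + ‖b‖ < δ. Outside it, c
  -- > 1/2 and ‖b‖ < 1/2 keep the moved point beyond R.
  refine ⟨min (1 / 2) (δ / (2 * R + 3)), by positivity, fun c b hcr hbr => ?_⟩
  obtain ⟨hc1, hc2⟩ := lt_min_iff.1 hcr
  obtain ⟨hb1, hb2⟩ := lt_min_iff.1 hbr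
  have hc3 := abs_lt.1 hc1
  have hb3 : ‖b.1‖ ≤ ‖b‖ := norm_fst_le b
  have hb4 : ‖b.2‖ ≤ ‖b‖ := norm_snd_le b
  rw [Real.norm_eq_abs] at hb4
  have hsupp : Function.support (fun z => ψ (affineShift c b z) - ψ z)
      ⊆ closedBall 0 (2 * R + 2) := by
    intro z hz
    by_contra hzR
    rw [mem_closedBall_zero_iff, not_le] at hzR
    refine hz ?_
    have hAz : R < ‖affineShift c b z‖ := by
      rcases max_cases ‖z.1‖ ‖z.2‖ with ⟨h1, _⟩ | ⟨h1, _⟩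
      · have h2 : ‖z‖ = ‖z.1‖ := h1
        refine lt_of_lt_of_le ?_ (norm_fst_le _)
        have h3 := norm_sub_le (z.1 + b.1) b.1
        rw [add_sub_cancel_right] at h3
        simp only [affineShift]
        linarith
      · have h2 : ‖z‖ = ‖z.2‖ := h1
        refine lt_of_lt_of_le ?_ (norm_snd_le _)
        have h3 := norm_sub_le (c * z.2 + b.2) b.2
        rw [add_sub_cancel_right, norm_mul, Real.norm_of_nonneg (by linarith : 0 ≤ c),
          Real.norm_eq_abs b.2] at h3
        simp only [affineShift]
        nlinarith
    simp only
    rw [hzero _ hAz, hzero z (by linarith), sub_zero]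
  rw [← eLpNorm_restrict_eq_of_support_subset hsupp]
  refine (eLpNorm_le_of_ae_bound (C := ε) ?_).trans ?_
  · refine (ae_restrict_iff' measurableSet_closedBall).2 (Eventually.of_forall fun z hz => ?_)
    rw [mem_closedBall_zero_iff] at hz
    rw [← dist_eq_norm]
    refine (hδε ?_).le
    have hz2 : |z.2| ≤ 2 * R + 2 := (norm_snd_le z).trans hz
    have hlt : |c - 1| * (2 * R + 2) + ‖b‖ < δ := by
      have hδ' : δ / (2 * R + 3) * (2 * R + 3) = δ := by field_simp
      nlinarith
    rw [dist_eq_norm]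
    refine lt_of_le_of_lt (max_le ?_ ?_) hlt
    · simp only [affineShift, Prod.fst_sub, add_sub_cancel_left]
      nlinarith [abs_nonneg (c - 1)]
    · simp only [affineShift, Prod.snd_sub]
      rw [show c * z.2 + b.2 - z.2 = (c - 1) * z.2 + b.2 by ring, Real.norm_eq_abs]
      refine (abs_add_le _ _).trans ?_
      rw [abs_mul]
      gcongr
  · rwa [Measure.restrict_apply_univ]

theorem exists_eLpNorm_comp_affineShift_sub_le {w : 𝔼 × ℝ → F} [NormedSpace ℝ F]
    (hw : MemLp w 2 volume) {κ : ℝ≥0∞} (hκ : κ ≠ 0) :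
    ∃ r > 0, ∀ (c : ℝ) (b : 𝔼 × ℝ), |c - 1| < r → ‖b‖ < r →
      eLpNorm (fun z => w (affineShift c b z) - w z) 2 volume ≤ κ := by
  have hκ4 : κ / 4 ≠ 0 := ENNReal.div_ne_zero.2 ⟨hκ, by simp⟩
  obtain ⟨ψ, hψc, hψw, hψ, hψm⟩ := hw.exists_hasCompactSupport_eLpNorm_sub_le (by simp) hκ4
  obtain ⟨r, hr, hrψ⟩ := exists_eLpNorm_comp_affineShift_sub_le_of_hasCompactSupport hψ hψc hκ4
  refine ⟨min r (1 / 2), by positivity, fun c b hc hb => ?_⟩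
  obtain ⟨hc1, hc2⟩ := lt_min_iff.1 hc
  obtain ⟨hb1, -⟩ := lt_min_iff.1 hb
  have hc0 : c ≠ 0 := by
    rintro rfl
    norm_num at hc2
  have hwψ : AEStronglyMeasurable (w - ψ) volume := hw.1.sub hψm.1
  have hq : Measure.QuasiMeasurePreserving (affineShift c b) :=
    ⟨measurable_affineShift c b, by
      rw [map_affineShift hc0]; exact Measure.smul_absolutelyContinuous⟩
  have hsplit : (fun z => w (affineShift c b z) - w z)
      = ((fun z => (w - ψ) (affineShift c b z)) + fun z => ψ (affineShift c b z) - ψ z)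
        - (w - ψ) := by
    ext z
    simp only [Pi.sub_apply, Pi.add_apply]
    abel
  have hm1 : AEStronglyMeasurable (fun z => (w - ψ) (affineShift c b z)) volume :=
    hwψ.comp_quasiMeasurePreserving hq
  have hm2 : AEStronglyMeasurable (fun z => ψ (affineShift c b z) - ψ z) volume :=
    (hψm.1.comp_quasiMeasurePreserving hq).sub hψm.1
  rw [hsplit]
  refine (eLpNorm_sub_le (hm1.add hm2) hwψ (by norm_num)).trans ?_
  refine (add_le_add_left (eLpNorm_add_le hm1 hm2 (by norm_num)) _).trans ?_
  calc _ ≤ 2 * (κ / 4) + κ / 4 + κ / 4 := by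
        gcongr
        · exact (eLpNorm_comp_affineShift_le hwψ hc2 b).trans (by gcongr)
        · exact hrψ c b hc1 hb1
    _ = 4 * (κ / 4) := by ring
    _ ≤ κ := ENNReal.mul_div_le

/-- The mollified function at a shifted point is an average, over the probability measure with
density `ρ.normed`, of w at points whose shift is b − y. Cauchy–Schwarz and Tonelli bound its L²
distance to w by the worst of these shifts. -/
theorem eLpNorm_normed_convolution_sub_le [NormedSpace ℝ F] [CompleteSpace F] {w : 𝔼 × ℝ → F}
    (hwm : StronglyMeasurable w) (hw : MemLp w 2 volume) (ρ : ContDiffBump (0 : 𝔼 × ℝ)) {c : ℝ}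
    {b : 𝔼 × ℝ} {κ : ℝ≥0∞} (h : ∀ y : 𝔼 × ℝ, ‖y‖ < ρ.rOut →
      eLpNorm (fun z => w (affineShift c (b - y) z) - w z) 2 volume ≤ κ) :
    eLpNorm (fun z => (ρ.normed volume ⋆[ContinuousLinearMap.lsmul ℝ ℝ, volume] w)
      (affineShift c b z) - w z) 2 volume ≤ κ := by
  set ρn := ρ.normed volume with hρn
  have hconv : ∀ z, Integrable (fun y => ρn y • w (z - y)) volume := fun z =>
    (ρ.hasCompactSupport_normed.convolutionExists_left (ContinuousLinearMap.lsmul ℝ ℝ)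
      ρ.continuous_normed (hw.locallyIntegrable (by norm_num)) z).integrable
  set P : Measure (𝔼 × ℝ) := volume.withDensity fun y => ENNReal.ofReal (ρn y) with hP
  have hPm : Measurable fun y => ENNReal.ofReal (ρn y) :=
    ENNReal.measurable_ofReal.comp ρ.continuous_normed.measurable
  have hP1 : P univ = 1 := by
    rw [hP, withDensity_apply _ MeasurableSet.univ, Measure.restrict_univ,
      ← ofReal_integral_eq_lintegral_ofReal ρ.integrable_normed
        (Eventually.of_forall ρ.nonneg_normed), ρ.integral_normed, ENNReal.ofReal_one]
  have : IsProbabilityMeasure P := ⟨hP1⟩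
  have hsm : ∀ z, StronglyMeasurable fun y => w (affineShift c b z - y) - w z := fun z =>
    (hwm.comp_measurable (by fun_prop)).sub stronglyMeasurable_const
  have hjoint : StronglyMeasurable fun q : (𝔼 × ℝ) × (𝔼 × ℝ) =>
      w (affineShift c b q.1 - q.2) - w q.1 :=
    (hwm.comp_measurable (((measurable_affineShift c b).comp measurable_fst).sub
      measurable_snd)).sub (hwm.comp_measurable measurable_fst)
  have hpt : ∀ z, ‖(ρn ⋆[ContinuousLinearMap.lsmul ℝ ℝ, volume] w) (affineShift c b z) - w z‖ₑ ^ 2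
      ≤ ∫⁻ y, ‖w (affineShift c b z - y) - w z‖ₑ ^ 2 ∂P := by
    intro z
    have h1 : (ρn ⋆[ContinuousLinearMap.lsmul ℝ ℝ, volume] w) (affineShift c b z) - w z
        = ∫ y, ρn y • (w (affineShift c b z - y) - w z) := by
      simp_rw [smul_sub]
      rw [integral_sub (hconv _) (ρ.integrable_normed.smul_const _), convolution_lsmul,
        integral_smul_const, ρ.integral_normed, one_smul]
    calc _ ≤ (∫⁻ y, ‖ρn y • (w (affineShift c b z - y) - w z)‖ₑ) ^ 2 := by
          rw [h1]; gcongr; exact enorm_integral_le_lintegral_enorm _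
      _ = (∫⁻ y, ‖w (affineShift c b z - y) - w z‖ₑ ∂P) ^ 2 := by
          rw [hP, lintegral_withDensity_eq_lintegral_mul _ hPm (hsm z).enorm]
          congr 2 with y
          rw [enorm_smul, Pi.mul_apply, Real.enorm_of_nonneg (ρ.nonneg_normed y)]
      _ ≤ _ := by
          simpa [hP1] using lintegral_sq_le P (hsm z).enorm.aemeasurable
  rw [← ENNReal.pow_le_pow_left_iff two_ne_zero, eLpNorm_two_sq]
  calc _ ≤ ∫⁻ z, ∫⁻ y, ‖w (affineShift c b z - y) - w z‖ₑ ^ 2 ∂P := lintegral_mono hpt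
    _ = ∫⁻ y, (∫⁻ z, ‖w (affineShift c b z - y) - w z‖ₑ ^ 2) ∂P :=
        lintegral_lintegral_swap (hjoint.enorm.pow_const 2).aemeasurable
    _ = ∫⁻ y, ENNReal.ofReal (ρn y) * ∫⁻ z, ‖w (affineShift c b z - y) - w z‖ₑ ^ 2 := by
        rw [hP, lintegral_withDensity_eq_lintegral_mul _ hPm]
        · rfl
        · exact (hjoint.enorm.pow_const 2).lintegral_prod_left'
    _ ≤ ∫⁻ y, ENNReal.ofReal (ρn y) * κ ^ 2 := by
        refine lintegral_mono fun y => ?_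
        by_cases hy : y ∈ Function.support ρn
        · rw [hρn, ρ.support_normed_eq, mem_ball_zero_iff] at hy
          simp only [affineShift_sub]
          rw [← eLpNorm_two_sq]
          gcongr
          exact h y hy
        · rw [Function.notMem_support.1 hy, ENNReal.ofReal_zero, zero_mul, zero_mul]
    _ = κ ^ 2 := by
        rw [lintegral_mul_const _ hPm, ← ofReal_integral_eq_lintegral_ofReal ρ.integrable_normed
          (Eventually.of_forall ρ.nonneg_normed), ρ.integral_normed, ENNReal.ofReal_one, one_mul]

/-- Mollification composed with affine maps near the identity approximates the identity of `L²`. -/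
theorem exists_eLpNorm_normed_convolution_affineShift_sub_le [NormedSpace ℝ F] [CompleteSpace F]
    {w : 𝔼 × ℝ → F} (hwm : StronglyMeasurable w) (hw : MemLp w 2 volume) {κ : ℝ≥0∞} (hκ : κ ≠ 0) :
    ∃ r > 0, ∀ (c : ℝ) (b : 𝔼 × ℝ) (ρ : ContDiffBump (0 : 𝔼 × ℝ)), |c - 1| < r →
      ‖b‖ + ρ.rOut < r →
      eLpNorm (fun z => (ρ.normed volume ⋆[ContinuousLinearMap.lsmul ℝ ℝ, volume] w)
        (affineShift c b z) - w z) 2 volume ≤ κ := by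
  obtain ⟨r, hr, hrw⟩ := exists_eLpNorm_comp_affineShift_sub_le hw hκ
  refine ⟨r, hr, fun c b ρ hc hb => eLpNorm_normed_convolution_sub_le hwm hw ρ fun y hy => ?_⟩
  exact hrw c _ hc ((norm_sub_le _ _).trans_lt (by linarith))

end

/-- When the ball about z lies in Ω, y ↦ ρ(z − y) is an admissible test function. The jump of the
zero extension across the boundary of Ω is therefore invisible at z. -/
theorem HasWeakGradient.fderiv_normed_convolution {Ω : Set (𝔼 × ℝ)} (hΩ : MeasurableSet Ω)
    {u : 𝔼 × ℝ → ℝ} {G : 𝔼 × ℝ → WithLp 2 (𝔼 × ℝ)} (h : HasWeakGradient Ω u G)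
    (hu : LocallyIntegrable (Ω.indicator u) volume) (hG : LocallyIntegrable (Ω.indicator G) volume)
    (ρ : ContDiffBump (0 : 𝔼 × ℝ)) {z : 𝔼 × ℝ} (hz : closedBall z ρ.rOut ⊆ Ω)
    (v : WithLp 2 (𝔼 × ℝ)) :
    fderiv ℝ (ρ.normed volume ⋆[ContinuousLinearMap.lsmul ℝ ℝ, volume] Ω.indicator u) z
        (v.fst, v.snd)
      = inner ℝ ((ρ.normed volume ⋆[ContinuousLinearMap.lsmul ℝ ℝ, volume] Ω.indicator G) z) v := by
  set ρn := ρ.normed volume with hρn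
  have hρ1 : ContDiff ℝ 1 ρn := ρ.contDiff_normed (n := 1)
  have hρc : HasCompactSupport ρn := ρ.hasCompactSupport_normed
  set a : 𝔼 × ℝ := (v.fst, v.snd) with ha
  set φ : 𝔼 × ℝ → ℝ := fun y => ρn (z - y) with hφ
  have hφs : ContDiff ℝ ((⊤ : ℕ∞) : WithTop ℕ∞) φ :=
    (ρ.contDiff_normed (n := ⊤)).comp (contDiff_const.sub contDiff_id)
  have hφt : tsupport φ ⊆ closedBall z ρ.rOut := by
    refine closure_minimal (fun y hy => ?_) isClosed_closedBall
    have : z - y ∈ Function.support ρn := hy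
    rw [hρn, ρ.support_normed_eq, mem_ball_zero_iff] at this
    rw [mem_closedBall, dist_comm, dist_eq_norm]
    exact this.le
  have hφc : HasCompactSupport φ :=
    (isCompact_closedBall z ρ.rOut).of_isClosed_subset (isClosed_tsupport φ) hφt
  have hφd : ∀ y, fderiv ℝ φ y a = - fderiv ℝ ρn (z - y) a := fun y => by
    have h1 : HasFDerivAt φ (fderiv ℝ ρn (z - y) ∘L (-ContinuousLinearMap.id ℝ (𝔼 × ℝ))) y :=
      ((hρ1.differentiable one_ne_zero) (z - y)).hasFDerivAt.comp y
        ((hasFDerivAt_id y).const_sub z)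
    rw [h1.fderiv]
    simp
  have hweak := h φ hφs hφc (hφt.trans hz) v
  rw [(hρc.hasFDerivAt_convolution_left (ContinuousLinearMap.lsmul ℝ ℝ) hρ1 hu z).fderiv]
  have hInt := ((hρc.fderiv ℝ).convolutionExists_left
    ((ContinuousLinearMap.lsmul ℝ ℝ : ℝ →L[ℝ] ℝ →L[ℝ] ℝ).precompL (𝔼 × ℝ))
    (hρ1.continuous_fderiv one_ne_zero) hu z).integrable
  have hIntG := (hρc.convolutionExists_left (ContinuousLinearMap.lsmul ℝ ℝ)
    ρ.continuous_normed hG z).integrable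
  rw [convolution_def, ContinuousLinearMap.integral_apply hInt]
  simp only [ContinuousLinearMap.precompL_apply, ContinuousLinearMap.lsmul_apply, smul_eq_mul]
  rw [← integral_sub_left_eq_self _ volume z]
  simp only [sub_sub_cancel]
  have hL : ∫ y, fderiv ℝ ρn (z - y) a * Ω.indicator u y = ∫ y in Ω, inner ℝ (G y) v * φ y := by
    rw [← neg_eq_iff_eq_neg.2 hweak, ← integral_neg, ← integral_indicator hΩ]
    refine integral_congr_ae (Eventually.of_forall fun y => ?_)
    by_cases hy : y ∈ Ω
    · simp only [indicator_of_mem hy]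
      rw [← ha, hφd]
      ring
    · simp only [indicator_of_notMem hy, mul_zero]
  have hR : inner ℝ ((ρn ⋆[ContinuousLinearMap.lsmul ℝ ℝ, volume] Ω.indicator G) z) v
      = ∫ y in Ω, inner ℝ (G y) v * φ y := by
    rw [convolution_lsmul, real_inner_comm, ← integral_inner (by simpa using hIntG),
      ← integral_sub_left_eq_self _ volume z, ← integral_indicator hΩ]
    refine integral_congr_ae (Eventually.of_forall fun y => ?_)
    by_cases hy : y ∈ Ω
    · simp only [sub_sub_cancel, indicator_of_mem hy, hφ, real_inner_smul_right,
        real_inner_comm v (G y)]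
      ring
    · simp only [sub_sub_cancel, indicator_of_notMem hy, smul_zero, inner_zero_right]
  exact hL.trans hR.symm

/-! ### Inward shifts and their patching -/

theorem exists_contDiff_partition {K : Set 𝔼} (hK : IsClosed K) {t : Finset 𝔼} {r : 𝔼 → ℝ}
    (hcover : K ⊆ ⋃ p ∈ t, ball p (r p)) :
    ∃ χ : t → 𝔼 → ℝ, (∀ p, ContDiff ℝ 1 (χ p)) ∧ (∀ p x, 0 ≤ χ p x) ∧
      (∀ p x, χ p x ≠ 0 → dist x p < r p) ∧ (∀ x ∈ K, ∑ p, χ p x = 1) ∧ ∀ p x, χ p x ≤ 1 := by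
  obtain ⟨f, hf⟩ := SmoothPartitionOfUnity.exists_isSubordinate (modelWithCornersSelf ℝ 𝔼) hK
    (fun p : t => ball (p : 𝔼) (r p)) (fun _ => isOpen_ball) (by simpa [iUnion_subtype] using hcover)
  refine ⟨fun p => f p, fun p => ?_, fun p x => f.nonneg p x, fun p x hx => ?_, fun x hx => ?_,
    fun p x => f.le_one p x⟩
  · exact (f p).contMDiff.contDiff.of_le (by exact_mod_cast le_top)
  · exact hf p (subset_tsupport _ hx)
  · rw [← finsum_eq_sum_of_fintype]
    exact f.sum_eq_one hx

/-- The compression lowers the height bound by at least μm, the vertical shift and δ return at most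
3μm/8, and η varies by at most μm/2 over the horizontal displacement εN. The shift μm/4 ≥ 2δ keeps
the ball above height 0. The case θ = η x is included, so graph points are also moved inside. -/
theorem closedBall_affineShift_subset {ω : Set 𝔼} {η : 𝔼 → ℝ} {H α : ℝ≥0}
    (hη : HolderOnWith H α η (closure ω)) {m : ℝ} (hm0 : 0 < m) {x v : 𝔼} (hx : x ∈ ω)
    (hm : m ≤ η x) {ε δ μ N : ℝ} (hε : 0 < ε) (hN : ‖v‖ + 1 ≤ N) (hδε : δ < ε)
    (hball : ball (x + ε • v) ε ⊆ ω) (hμ : 0 < μ) (hμ1 : μ < 1)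
    (hHε : H * (ε * N) ^ (α : ℝ) ≤ μ * m / 2) (hδμ : δ ≤ μ * m / 8) {θ : ℝ} (hθ0 : 0 < θ)
    (hθ : θ ≤ η x) :
    closedBall (affineShift (1 - μ) (ε • v, μ * m / 4) (x, θ)) δ ⊆ subgraphDomain ω η := by
  rintro ⟨y, τ⟩ hy
  rw [mem_closedBall, Prod.dist_eq, max_le_iff] at hy
  obtain ⟨hy1, hy2⟩ := hy
  simp only [affineShift] at hy1 hy2
  rw [Real.dist_eq, abs_le] at hy2
  have hyω : y ∈ ω := hball (hy1.trans_lt hδε)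
  have hdist : dist y x ≤ ε * N := by
    have h1 := dist_triangle y (x + ε • v) x
    have h2 : dist (x + ε • v) x = ε * ‖v‖ := by
      rw [dist_eq_norm, add_sub_cancel_left, norm_smul, Real.norm_of_nonneg hε.le]
    nlinarith
  have hosc := (hη.dist_le_of_le (subset_closure hyω) (subset_closure hx) hdist).trans hHε
  rw [Real.dist_eq, abs_le] at hosc
  have hμm : 0 < μ * m := by positivity
  refine ⟨hyω, ?_, ?_⟩ <;> simp only
  · nlinarith [mul_pos (sub_pos.2 hμ1) hθ0]
  · have h1 : (1 - μ) * θ ≤ (1 - μ) * η x := by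
      have := sub_pos.2 hμ1
      gcongr
    nlinarith

theorem hasFDerivAt_affineShift (c : ℝ) (b z : 𝔼 × ℝ) :
    HasFDerivAt (affineShift c b) ((ContinuousLinearMap.fst ℝ 𝔼 ℝ).prod
      (c • ContinuousLinearMap.snd ℝ 𝔼 ℝ)) z :=
  (hasFDerivAt_fst.add_const b.1).prodMk ((hasFDerivAt_snd.const_mul c).add_const b.2)

theorem contDiff_affineShift (c : ℝ) (b : 𝔼 × ℝ) : ContDiff ℝ 1 (affineShift c b) := by
  unfold affineShift
  fun_prop

/-- Patching shifted copies of `W` by the functions `χ p` of the horizontal variable. -/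
noncomputable def patch {t : Finset 𝔼} (χ : t → 𝔼 → ℝ) (W : 𝔼 × ℝ → ℝ) (c : ℝ)
    (b : t → 𝔼 × ℝ) (z : 𝔼 × ℝ) : ℝ :=
  ∑ p, χ p z.1 * W (affineShift c (b p) z)

section

variable {t : Finset (EuclideanSpace ℝ (Fin d))} {χ : t → EuclideanSpace ℝ (Fin d) → ℝ}
  {W : EuclideanSpace ℝ (Fin d) × ℝ → ℝ}

theorem contDiff_patch (hχ : ∀ p, ContDiff ℝ 1 (χ p)) (hW : ContDiff ℝ 1 W) (c : ℝ)
    (b : t → 𝔼 × ℝ) : ContDiff ℝ 1 (patch χ W c b) :=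
  ContDiff.sum fun p _ => ((hχ p).comp contDiff_fst).mul (hW.comp (contDiff_affineShift c (b p)))

theorem fderiv_patch (hχ : ∀ p, ContDiff ℝ 1 (χ p)) (hW : ContDiff ℝ 1 W) (c : ℝ)
    (b : t → 𝔼 × ℝ) (z a : 𝔼 × ℝ) :
    fderiv ℝ (patch χ W c b) z a = ∑ p, (fderiv ℝ (χ p) z.1 a.1 * W (affineShift c (b p) z)
      + χ p z.1 * fderiv ℝ W (affineShift c (b p) z) (a.1, c * a.2)) := by
  have h : HasFDerivAt (patch χ W c b) (∑ p, (χ p z.1 • (fderiv ℝ W (affineShift c (b p) z) ∘L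
      ((ContinuousLinearMap.fst ℝ 𝔼 ℝ).prod (c • ContinuousLinearMap.snd ℝ 𝔼 ℝ)))
      + W (affineShift c (b p) z) • (fderiv ℝ (χ p) z.1 ∘L ContinuousLinearMap.fst ℝ 𝔼 ℝ))) z := by
    refine HasFDerivAt.fun_sum fun p _ => ?_
    exact (((hχ p).differentiable one_ne_zero z.1).hasFDerivAt.comp z hasFDerivAt_fst).mul
      ((hW.differentiable one_ne_zero _).hasFDerivAt.comp z (hasFDerivAt_affineShift c (b p) z))
  rw [h.fderiv, sum_apply]
  refine Finset.sum_congr rfl fun p _ => ?_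
  simp
  ring

theorem abs_patch_sub_le (hχ0 : ∀ p x, 0 ≤ χ p x) {c : ℝ} {b : t → 𝔼 × ℝ} {z : 𝔼 × ℝ}
    (hsum : ∑ p, χ p z.1 = 1) {y κ : ℝ}
    (h : ∀ p, χ p z.1 ≠ 0 → |W (affineShift c (b p) z) - y| ≤ κ) :
    |patch χ W c b z - y| ≤ κ := by
  have h1 : patch χ W c b z - y = ∑ p, χ p z.1 * (W (affineShift c (b p) z) - y) := by
    simp_rw [mul_sub]
    rw [Finset.sum_sub_distrib, ← Finset.sum_mul, hsum, one_mul, patch]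
  rw [h1]
  calc _ ≤ ∑ p, χ p z.1 * κ := (Finset.abs_sum_le_sum_abs _ _).trans
        (Finset.sum_le_sum fun p _ => by
          rw [abs_mul, abs_of_nonneg (hχ0 p _)]
          by_cases hp : χ p z.1 = 0
          · rw [hp, zero_mul, zero_mul]
          · exact mul_le_mul_of_nonneg_left (h p hp) (hχ0 p _))
    _ = κ := by rw [← Finset.sum_mul, hsum, one_mul]

/-- The weights are dropped so that each summand can be measured over the whole space, where the L²
mollification estimate lives. -/
theorem norm_patch_sub_le (hχ0 : ∀ p x, 0 ≤ χ p x) (hχ1 : ∀ p x, χ p x ≤ 1) {c : ℝ}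
    {b : t → 𝔼 × ℝ} {z : 𝔼 × ℝ} (hsum : ∑ p, χ p z.1 = 1) (y : ℝ) :
    ‖patch χ W c b z - y‖ ≤ ∑ p, ‖W (affineShift c (b p) z) - y‖ := by
  have h1 : patch χ W c b z - y = ∑ p, χ p z.1 * (W (affineShift c (b p) z) - y) := by
    simp_rw [mul_sub]
    rw [Finset.sum_sub_distrib, ← Finset.sum_mul, hsum, one_mul, patch]
  rw [h1]
  refine (norm_sum_le _ _).trans (Finset.sum_le_sum fun p _ => ?_)
  rw [norm_mul, Real.norm_of_nonneg (hχ0 p _)]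
  exact mul_le_of_le_one_left (norm_nonneg _) (hχ1 p _)

/-- The derivatives of the partition sum to zero, so they multiply W − y rather than W. The chain
rule scales the vertical component by c, which costs (1 − c)‖G‖. The error vector v is tested
against itself and one factor ‖v‖ is cancelled. -/
theorem norm_prodGradient_patch_sub_le (hχ : ∀ p, ContDiff ℝ 1 (χ p)) (hχ0 : ∀ p x, 0 ≤ χ p x)
    (hχ1 : ∀ p x, χ p x ≤ 1) (hW : ContDiff ℝ 1 W) {c : ℝ} (hc0 : 0 ≤ c) (hc1 : c ≤ 1)
    {b : t → 𝔼 × ℝ} {z : 𝔼 × ℝ} (hsum : ∀ᶠ x in 𝓝 z.1, ∑ p, χ p x = 1) {K : ℝ}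
    (hK : ∀ p, ‖fderiv ℝ (χ p) z.1‖ ≤ K) {g : t → WithLp 2 (𝔼 × ℝ)}
    (hg : ∀ p, χ p z.1 ≠ 0 → ∀ v : WithLp 2 (𝔼 × ℝ),
      fderiv ℝ W (affineShift c (b p) z) (v.fst, v.snd) = inner ℝ (g p) v)
    (y : ℝ) (G : WithLp 2 (𝔼 × ℝ)) :
    ‖prodGradient (patch χ W c b) z - G‖
      ≤ ∑ p, (K * ‖W (affineShift c (b p) z) - y‖ + ‖g p - G‖ + (1 - c) * ‖G‖) := by
  set v := prodGradient (patch χ W c b) z - G with hv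
  set S := ∑ p, (K * ‖W (affineShift c (b p) z) - y‖ + ‖g p - G‖ + (1 - c) * ‖G‖) with hS
  have hsum0 : ∑ p, χ p z.1 = 1 := hsum.self_of_nhds
  have hdsum : ∑ p, fderiv ℝ (χ p) z.1 = 0 := by
    have h1 : HasFDerivAt (fun x => ∑ p, χ p x) (∑ p, fderiv ℝ (χ p) z.1) z.1 :=
      HasFDerivAt.fun_sum fun p _ => ((hχ p).differentiable one_ne_zero z.1).hasFDerivAt
    have h2 : HasFDerivAt (fun x => ∑ p, χ p x) (0 : 𝔼 →L[ℝ] ℝ) z.1 :=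
      (hasFDerivAt_const (1 : ℝ) z.1).congr_of_eventuallyEq hsum
    exact h1.unique h2
  have hv1 : ‖v.fst‖ ≤ ‖v‖ := WithLp.norm_fst_le (p := 2) (α := 𝔼) (β := ℝ) v
  have hv2 : ‖v.snd‖ ≤ ‖v‖ := WithLp.norm_snd_le (p := 2) (α := 𝔼) (β := ℝ) v
  -- v' is the direction the shifted function sees by the chain rule, and v'' is the vertical
  -- remainder.
  set v' : WithLp 2 (𝔼 × ℝ) := WithLp.toLp 2 (v.fst, c * v.snd) with hv'
  set v'' : WithLp 2 (𝔼 × ℝ) := WithLp.toLp 2 (0, (1 - c) * v.snd) with hv''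
  have hvv : v = v' + v'' := by
    refine WithLp.ofLp_injective 2 (Prod.ext ?_ ?_)
    · change v.fst = v.fst + 0
      rw [add_zero]
    · change v.snd = c * v.snd + (1 - c) * v.snd
      ring
  have hnv' : ‖v'‖ ≤ ‖v‖ := by
    rw [WithLp.prod_norm_eq_of_L2, WithLp.prod_norm_eq_of_L2]
    refine Real.sqrt_le_sqrt ?_
    change ‖v.fst‖ ^ 2 + ‖c * v.snd‖ ^ 2 ≤ _
    rw [norm_mul, Real.norm_of_nonneg hc0, mul_pow]
    have : c ^ 2 ≤ 1 := pow_le_one₀ hc0 hc1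
    nlinarith [sq_nonneg ‖v.snd‖]
  have hnv'' : ‖v''‖ ≤ (1 - c) * ‖v‖ := by
    rw [WithLp.prod_norm_eq_of_L2 v'']
    change √(‖(0 : 𝔼)‖ ^ 2 + ‖(1 - c) * v.snd‖ ^ 2) ≤ _
    rw [norm_zero, norm_mul, Real.norm_of_nonneg (sub_nonneg.2 hc1), zero_pow two_ne_zero, zero_add,
      Real.sqrt_sq (mul_nonneg (sub_nonneg.2 hc1) (norm_nonneg _))]
    exact mul_le_mul_of_nonneg_left hv2 (sub_nonneg.2 hc1)
  have hexp : inner ℝ v v = ∑ p, (fderiv ℝ (χ p) z.1 v.fst * (W (affineShift c (b p) z) - y)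
      + χ p z.1 * (inner ℝ (g p - G) v' - inner ℝ G v'')) := by
    have e1 : inner ℝ v v = fderiv ℝ (patch χ W c b) z (v.fst, v.snd) - inner ℝ G v := by
      conv_lhs => rw [hv, inner_sub_left, ← hv, inner_prodGradient]
    have e2 : ∀ p, χ p z.1 * fderiv ℝ W (affineShift c (b p) z) (v.fst, c * v.snd)
        = χ p z.1 * inner ℝ (g p) v' := fun p => by
      by_cases hp : χ p z.1 = 0
      · rw [hp, zero_mul, zero_mul]
      · rw [← hg p hp v']
        rfl
    have e3 : ∑ p, fderiv ℝ (χ p) z.1 v.fst * y = 0 := by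
      rw [← Finset.sum_mul, ← sum_apply, hdsum]
      simp
    have e5 : inner ℝ G v = inner ℝ G v' + inner ℝ G v'' := by rw [← inner_add_right, ← hvv]
    have e4 : inner ℝ G v = ∑ p, χ p z.1 * inner ℝ G v := by
      rw [← Finset.sum_mul, hsum0, one_mul]
    rw [e1, fderiv_patch hχ hW, e4, ← Finset.sum_sub_distrib, ← sub_zero (Finset.sum _ _), ← e3,
      ← Finset.sum_sub_distrib]
    refine Finset.sum_congr rfl fun p _ => ?_
    simp only
    rw [e2]
    rw [inner_sub_left, e5]
    ring
  have hbound : ‖v‖ * ‖v‖ ≤ S * ‖v‖ := by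
    rw [← real_inner_self_eq_norm_mul_norm, hexp, hS, Finset.sum_mul]
    refine Finset.sum_le_sum fun p _ => ?_
    have b1 : fderiv ℝ (χ p) z.1 v.fst * (W (affineShift c (b p) z) - y)
        ≤ K * ‖W (affineShift c (b p) z) - y‖ * ‖v‖ := by
      refine (le_abs_self _).trans ?_
      rw [abs_mul, ← Real.norm_eq_abs, ← Real.norm_eq_abs]
      have := ((fderiv ℝ (χ p) z.1).le_opNorm v.fst).trans
        (mul_le_mul (hK p) hv1 (norm_nonneg _) ((norm_nonneg _).trans (hK p)))
      calc _ ≤ K * ‖v‖ * ‖W (affineShift c (b p) z) - y‖ := by gcongr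
        _ = _ := by ring
    have b2 : inner ℝ (g p - G) v' - inner ℝ G v'' ≤ (‖g p - G‖ + (1 - c) * ‖G‖) * ‖v‖ := by
      have i1 := (abs_le.1 (abs_real_inner_le_norm (g p - G) v')).2
      have i2 := (abs_le.1 (abs_real_inner_le_norm G v'')).1
      have i3 := mul_le_mul_of_nonneg_left hnv' (norm_nonneg (g p - G))
      have i4 := mul_le_mul_of_nonneg_left hnv'' (norm_nonneg G)
      nlinarith
    have b3 : χ p z.1 * (inner ℝ (g p - G) v' - inner ℝ G v'')
        ≤ (‖g p - G‖ + (1 - c) * ‖G‖) * ‖v‖ := by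
      have hnn : 0 ≤ (‖g p - G‖ + (1 - c) * ‖G‖) * ‖v‖ := by
        have := sub_nonneg.2 hc1
        positivity
      exact (mul_le_mul_of_nonneg_left b2 (hχ0 p _)).trans
        (mul_le_of_le_one_left hnn (hχ1 p _))
    linarith
  rcases (norm_nonneg v).eq_or_lt with h0 | h0
  · rw [← h0]
    refine Finset.sum_nonneg fun p _ => ?_
    have := sub_nonneg.2 hc1
    have := (norm_nonneg _).trans (hK p)
    positivity
  · exact le_of_mul_le_mul_right hbound h0

end

theorem graph_mem_closure_subgraphDomain {ω : Set 𝔼} {η : 𝔼 → ℝ} {x : 𝔼} (hx : x ∈ ω)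
    (hη : 0 < η x) : (x, η x) ∈ closure (subgraphDomain ω η) := by
  have h : η x ∈ closure (Ioo 0 (η x)) := by
    rw [closure_Ioo hη.ne]
    exact ⟨hη.le, le_rfl⟩
  exact map_mem_closure (f := fun θ : ℝ => (x, θ)) (by fun_prop) h fun θ hθ => ⟨hx, hθ.1, hθ.2⟩

theorem eLpNorm_fun_sum_le {X ι : Type*} [MeasurableSpace X] {μ : Measure X} (t : Finset ι)
    {f : ι → X → ℝ} (hf : ∀ p ∈ t, AEStronglyMeasurable (f p) μ) :
    eLpNorm (fun z => ∑ p ∈ t, f p z) 2 μ ≤ ∑ p ∈ t, eLpNorm (f p) 2 μ := by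
  have h := eLpNorm_sum_le (p := 2) (μ := μ) hf (by norm_num)
  rwa [show (∑ p ∈ t, f p) = fun z => ∑ p ∈ t, f p z by ext z; simp] at h

section

variable {t : Finset (EuclideanSpace ℝ (Fin d))} {χ : t → EuclideanSpace ℝ (Fin d) → ℝ}
  {W : EuclideanSpace ℝ (Fin d) × ℝ → ℝ} {Ω : Set (EuclideanSpace ℝ (Fin d) × ℝ)}
  {c : ℝ} {b : t → EuclideanSpace ℝ (Fin d) × ℝ} {u : EuclideanSpace ℝ (Fin d) × ℝ → ℝ}

theorem eLpNorm_patch_sub_le (hΩ : MeasurableSet Ω) (hχ0 : ∀ p x, 0 ≤ χ p x)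
    (hχ1 : ∀ p x, χ p x ≤ 1) (hsum : ∀ z ∈ Ω, ∑ p, χ p z.1 = 1) (hWc : Continuous W)
    (hum : StronglyMeasurable u) {κ : ℝ≥0∞}
    (hWu : ∀ p, eLpNorm (fun z => W (affineShift c (b p) z) - u z) 2 volume ≤ κ) :
    eLpNorm (fun z => patch χ W c b z - u z) 2 (volume.restrict Ω) ≤ Fintype.card t * κ := by
  have hWm : ∀ p, AEStronglyMeasurable (fun z => W (affineShift c (b p) z) - u z) volume :=
    fun p => (hWc.comp (contDiff_affineShift c (b p)).continuous).aestronglyMeasurable.sub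
      hum.aestronglyMeasurable
  calc _ ≤ eLpNorm (fun z => ∑ p, ‖W (affineShift c (b p) z) - u z‖) 2 (volume.restrict Ω) := by
        refine eLpNorm_mono_ae_real ?_
        exact (ae_restrict_iff' hΩ).2 (Eventually.of_forall fun z hz =>
          norm_patch_sub_le hχ0 hχ1 (hsum z hz) _)
    _ ≤ eLpNorm (fun z => ∑ p, ‖W (affineShift c (b p) z) - u z‖) 2 volume :=
        eLpNorm_mono_measure _ Measure.restrict_le_self
    _ ≤ ∑ p : t, eLpNorm (fun z => ‖W (affineShift c (b p) z) - u z‖) 2 volume :=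
        eLpNorm_fun_sum_le _ fun p _ => (hWm p).norm
    _ ≤ ∑ _p : t, κ := Finset.sum_le_sum fun p _ => by rw [eLpNorm_norm]; exact hWu p
    _ = _ := by rw [Finset.sum_const, nsmul_eq_mul, Finset.card_univ]

theorem eLpNorm_prodGradient_patch_sub_le (hΩ : MeasurableSet Ω) (hχ : ∀ p, ContDiff ℝ 1 (χ p))
    (hχ0 : ∀ p x, 0 ≤ χ p x) (hχ1 : ∀ p x, χ p x ≤ 1)
    (hsum : ∀ z ∈ Ω, ∀ᶠ x in 𝓝 z.1, ∑ p, χ p x = 1) (hW : ContDiff ℝ 1 W)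
    (hum : StronglyMeasurable u) {V G : 𝔼 × ℝ → WithLp 2 (𝔼 × ℝ)} (hVc : Continuous V)
    (hGm : StronglyMeasurable G) (hc0 : 0 ≤ c) (hc1 : c ≤ 1) {K : ℝ} (hK0 : 0 ≤ K)
    (hK : ∀ p, ∀ z ∈ Ω, ‖fderiv ℝ (χ p) z.1‖ ≤ K)
    (hV : ∀ p, ∀ z ∈ Ω, χ p z.1 ≠ 0 → ∀ v : WithLp 2 (𝔼 × ℝ),
      fderiv ℝ W (affineShift c (b p) z) (v.fst, v.snd) = inner ℝ (V (affineShift c (b p) z)) v)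
    {κ : ℝ≥0∞} (hWu : ∀ p, eLpNorm (fun z => W (affineShift c (b p) z) - u z) 2 volume ≤ κ)
    (hVG : ∀ p, eLpNorm (fun z => V (affineShift c (b p) z) - G z) 2 volume ≤ κ) :
    eLpNorm (fun z => prodGradient (patch χ W c b) z - G z) 2 (volume.restrict Ω)
      ≤ Fintype.card t * (ENNReal.ofReal K * κ + κ
        + ENNReal.ofReal (1 - c) * eLpNorm G 2 volume) := by
  have hWm : ∀ p, AEStronglyMeasurable (fun z => K * ‖W (affineShift c (b p) z) - u z‖) volume :=
    fun p => (((hW.continuous.comp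
      (contDiff_affineShift c (b p)).continuous).aestronglyMeasurable.sub
      hum.aestronglyMeasurable).norm).const_mul K
  have hVm : ∀ p, AEStronglyMeasurable (fun z => ‖V (affineShift c (b p) z) - G z‖) volume :=
    fun p => ((hVc.comp (contDiff_affineShift c (b p)).continuous).aestronglyMeasurable.sub
      hGm.aestronglyMeasurable).norm
  have hGm' : AEStronglyMeasurable (fun z => (1 - c) * ‖G z‖) volume :=
    hGm.aestronglyMeasurable.norm.const_mul (1 - c)
  calc _ ≤ eLpNorm (fun z => ∑ p, (K * ‖W (affineShift c (b p) z) - u z‖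
          + ‖V (affineShift c (b p) z) - G z‖ + (1 - c) * ‖G z‖)) 2 (volume.restrict Ω) := by
        refine eLpNorm_mono_ae_real ?_
        exact (ae_restrict_iff' hΩ).2 (Eventually.of_forall fun z hz =>
          norm_prodGradient_patch_sub_le hχ hχ0 hχ1 hW hc0 hc1 (hsum z hz) (fun p => hK p z hz)
            (fun p => hV p z hz) (u z) (G z))
    _ ≤ eLpNorm (fun z => ∑ p, (K * ‖W (affineShift c (b p) z) - u z‖
          + ‖V (affineShift c (b p) z) - G z‖ + (1 - c) * ‖G z‖)) 2 volume :=
        eLpNorm_mono_measure _ Measure.restrict_le_self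
    _ ≤ ∑ p : t, eLpNorm (fun z => K * ‖W (affineShift c (b p) z) - u z‖
          + ‖V (affineShift c (b p) z) - G z‖ + (1 - c) * ‖G z‖) 2 volume :=
        eLpNorm_fun_sum_le _ fun p _ => ((hWm p).add (hVm p)).add hGm'
    _ ≤ ∑ _p : t, (ENNReal.ofReal K * κ + κ + ENNReal.ofReal (1 - c) * eLpNorm G 2 volume) :=
        Finset.sum_le_sum fun p _ => by
          refine (eLpNorm_add_le ((hWm p).add (hVm p)) hGm' (by norm_num)).trans (add_le_add
            ((eLpNorm_add_le (hWm p) (hVm p) (by norm_num)).trans (add_le_add ?_ ?_)) ?_)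
          · refine (eLpNorm_const_smul K
              (fun z => ‖W (affineShift c (b p) z) - u z‖) 2 volume).trans_le ?_
            rw [eLpNorm_norm, Real.enorm_of_nonneg hK0]
            gcongr
            exact hWu p
          · rw [eLpNorm_norm]
            exact hVG p
          · refine (eLpNorm_const_smul (1 - c) (fun z => ‖G z‖) 2 volume).trans_le ?_
            rw [eLpNorm_norm, Real.enorm_of_nonneg (sub_nonneg.2 hc1)]
    _ = _ := by rw [Finset.sum_const, nsmul_eq_mul, Finset.card_univ]

end

/-! ### Approximation in H¹ and on the graph -/

theorem abs_normed_convolution_sub_le {Ω : Set (𝔼 × ℝ)} (hΩ : MeasurableSet Ω)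
    {u₀ f : 𝔼 × ℝ → ℝ} (hum : StronglyMeasurable (Ω.indicator u₀))
    (hf : u₀ =ᵐ[volume.restrict Ω] f) (ρ : ContDiffBump (0 : 𝔼 × ℝ)) {x : 𝔼 × ℝ}
    (hx : closedBall x ρ.rOut ⊆ Ω) {y κ : ℝ} (hκ : 0 ≤ κ)
    (h : ∀ z ∈ Ω, dist z x < ρ.rOut → |f z - y| ≤ κ) :
    |(ρ.normed volume ⋆[ContinuousLinearMap.lsmul ℝ ℝ, volume] Ω.indicator u₀) x - y| ≤ κ := by
  have huf : Ω.indicator u₀ =ᵐ[volume] Ω.indicator f := by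
    filter_upwards [(ae_restrict_iff' hΩ).1 hf] with z hz
    by_cases hzΩ : z ∈ Ω
    · rw [indicator_of_mem hzΩ, indicator_of_mem hzΩ, hz hzΩ]
    · rw [indicator_of_notMem hzΩ, indicator_of_notMem hzΩ]
  rw [convolution_congr (f' := ρ.normed volume) (g' := Ω.indicator f) _ (ae_eq_refl _) huf,
    ← Real.dist_eq]
  refine dist_convolution_le hκ ρ.support_normed_eq.subset ρ.nonneg_normed
    ρ.integral_normed (hum.aestronglyMeasurable.congr huf) fun z hz => ?_
  have hzΩ : z ∈ Ω := hx (ball_subset_closedBall hz)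
  rw [indicator_of_mem hzΩ, Real.dist_eq]
  exact h z hzΩ hz

theorem dist_affineShift_le {c : ℝ} (hc : c ≤ 1) (b z : 𝔼 × ℝ) {M : ℝ} (hz : |z.2| ≤ M) :
    dist (affineShift c b z) z ≤ (1 - c) * M + ‖b‖ := by
  have h1 : ‖b.1‖ ≤ ‖b‖ := norm_fst_le _
  have h2 : |b.2| ≤ ‖b‖ := norm_snd_le b
  have hc' := sub_nonneg.2 hc
  rw [dist_eq_norm]
  refine max_le ?_ ?_
  · simp only [affineShift, Prod.fst_sub, add_sub_cancel_left]
    nlinarith [(abs_nonneg z.2).trans hz]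
  · simp only [affineShift, Prod.snd_sub, Real.norm_eq_abs]
    rw [show c * z.2 + b.2 - z.2 = b.2 - (1 - c) * z.2 by ring]
    refine (abs_sub _ _).trans ?_
    rw [abs_mul, abs_of_nonneg hc']
    nlinarith [mul_le_mul_of_nonneg_left hz hc']

/-- The order matters: the compression μ is fixed first, then ε is taken so small that the
oscillation of η over the horizontal shift fits into the gap μm/2. -/
theorem exists_shift_parameters {α m M R κ ρ n B : ℝ} (hα0 : 0 < α) (hm0 : 0 < m) (hM0 : 0 < M)
    (hR0 : 0 < R) (hκ : 0 < κ) (hρ : 0 < ρ) (hn0 : 0 ≤ n) (hB0 : 0 ≤ B) (H N : ℝ) :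
    ∃ μ ε : ℝ, 0 < μ ∧ μ < 1 ∧ μ * (M + m + 1) < R / 4 ∧ n * (μ * B) ≤ κ / 2 ∧
      0 < ε ∧ ε < ρ ∧ ε * N < R / 4 ∧ H * (ε * N) ^ α ≤ μ * m / 2 := by
  obtain ⟨μ, hμ0, hμ1, hμR, hμB⟩ : ∃ μ : ℝ, 0 < μ ∧ μ < 1 ∧ μ * (M + m + 1) < R / 4 ∧
      n * (μ * B) ≤ κ / 2 := by
    refine ⟨min (1 / 2) (min (R / (8 * (M + m + 1))) (κ / (2 * (n * B + 1)))), by positivity,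
      (min_le_left _ _).trans_lt (by norm_num), ?_, ?_⟩
    · have := (min_le_right (1 / 2) _).trans
        (min_le_left (R / (8 * (M + m + 1))) (κ / (2 * (n * B + 1))))
      refine (mul_le_mul_of_nonneg_right this (by positivity)).trans_lt ?_
      rw [div_mul_eq_mul_div, div_lt_div_iff₀ (by positivity) (by norm_num)]
      nlinarith [mul_pos hR0 (by positivity : 0 < M + m + 1)]
    · have := (min_le_right (1 / 2) _).trans
        (min_le_right (R / (8 * (M + m + 1))) (κ / (2 * (n * B + 1))))
      refine (mul_le_mul_of_nonneg_left (mul_le_mul_of_nonneg_right this hB0) hn0).trans ?_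
      rw [div_mul_eq_mul_div, mul_div_assoc', div_le_div_iff₀ (by positivity) (by norm_num)]
      nlinarith [mul_nonneg hn0 hB0]
  have hμm : 0 < μ * m := by positivity
  have hε : ∃ ε : ℝ, 0 < ε ∧ ε < ρ ∧ ε * N < R / 4 ∧
      H * (ε * N) ^ α ≤ μ * m / 2 := by
    have h1 : Tendsto (fun ε : ℝ => ε * N) (𝓝 0) (𝓝 0) := by
      simpa using (continuous_mul_const N).tendsto 0
    have h2 : Tendsto (fun ε : ℝ => H * (ε * N) ^ α) (𝓝 0) (𝓝 0) := by
      have h3 := ((Real.continuous_rpow_const hα0.le).tendsto 0).comp h1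
      rw [Real.zero_rpow hα0.ne'] at h3
      simpa using h3.const_mul H
    exact ((eventually_mem_nhdsWithin (a := (0 : ℝ)) (s := Ioi 0)).and
      (eventually_nhdsWithin_of_eventually_nhds ((eventually_lt_nhds hρ).and
        ((h1.eventually (eventually_lt_nhds (by positivity))).and
          (h2.eventually (eventually_le_nhds (by positivity))))))).exists
  obtain ⟨ε, hε⟩ := hε
  exact ⟨μ, ε, hμ0, hμ1, hμR, hμB, hε⟩

set_option maxHeartbeats 800000 in
/-- Functions of `H¹(Ω_η)` are approximated by `C¹` functions on the whole space, and on the graph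
of `η` uniformly if they are continuous up to the boundary. -/
theorem exists_contDiff_approx {ω : Set 𝔼} (hω : IsLipschitzDomain ω) {α : ℝ≥0} (hα0 : 0 < α)
    {η : 𝔼 → ℝ} {H : ℝ≥0} (hη : HolderOnWith H α η (closure ω)) {m M : ℝ} (hm0 : 0 < m)
    (hm : ∀ x ∈ ω, m ≤ η x) (hM : ∀ x ∈ ω, η x ≤ M) {u₀ : 𝔼 × ℝ → ℝ}
    {G₀ : 𝔼 × ℝ → WithLp 2 (𝔼 × ℝ)} (hu₀ : StronglyMeasurable u₀) (hG₀ : StronglyMeasurable G₀)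
    (hu₀L : MemLp u₀ 2 (volume.restrict (subgraphDomain ω η)))
    (hG₀L : MemLp G₀ 2 (volume.restrict (subgraphDomain ω η)))
    (hweak : HasWeakGradient (subgraphDomain ω η) u₀ G₀) {κ r₁ : ℝ} (hκ : 0 < κ) (hr₁ : 0 < r₁) :
    ∃ φ : 𝔼 × ℝ → ℝ, ContDiff ℝ 1 φ ∧
      eLpNorm (fun z => φ z - u₀ z) 2 (volume.restrict (subgraphDomain ω η))
        ≤ ENNReal.ofReal κ ∧
      eLpNorm (fun z => prodGradient φ z - G₀ z) 2 (volume.restrict (subgraphDomain ω η))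
        ≤ ENNReal.ofReal κ ∧
      ∀ f, u₀ =ᵐ[volume.restrict (subgraphDomain ω η)] f → ∀ κ',
        (∀ z ∈ closure (subgraphDomain ω η), ∀ w ∈ closure (subgraphDomain ω η),
          dist w z < r₁ → |f w - f z| ≤ κ') →
        ∀ x ∈ ω, |graphTrace η φ x - graphTrace η f x| ≤ κ' := by
  set Ω := subgraphDomain ω η with hΩdef
  have hα0' : (0 : ℝ) < α := by exact_mod_cast hα0
  have hΩo : IsOpen Ω := isOpen_subgraphDomain hω.isOpen
    ((hη.continuousOn hα0).mono subset_closure)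
  have hΩ : MeasurableSet Ω := hΩo.measurableSet
  have hmM : m ≤ M := by
    obtain ⟨x, hx⟩ := hω.isConnected.nonempty
    exact (hm x hx).trans (hM x hx)
  set u := Ω.indicator u₀ with hu
  set G := Ω.indicator G₀ with hG
  have hum : StronglyMeasurable u := hu₀.indicator hΩ
  have hGm : StronglyMeasurable G := hG₀.indicator hΩ
  have huL : MemLp u 2 volume := (memLp_indicator_iff_restrict hΩ).2 hu₀L
  have hGL : MemLp G 2 volume := (memLp_indicator_iff_restrict hΩ).2 hG₀L
  have hui := huL.locallyIntegrable (by norm_num)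
  have hGi := hGL.locallyIntegrable (by norm_num)
  obtain ⟨t, r, v, ρ, hρ, hcover, hcone⟩ := hω.exists_finite_cone_cover
  obtain ⟨χ, hχ, hχ0, hχr, hχsum, hχ1⟩ := exists_contDiff_partition isClosed_closure hcover
  obtain ⟨K, hK0, hK⟩ : ∃ K : ℝ, 0 ≤ K ∧ ∀ p : t, ∀ x ∈ ω, ‖fderiv ℝ (χ p) x‖ ≤ K := by
    choose K hK using fun p : t => hω.isBounded.isCompact_closure.exists_bound_of_continuousOn
      ((hχ p).continuous_fderiv one_ne_zero).continuousOn
    refine ⟨∑ p, |K p|, Finset.sum_nonneg fun _ _ => abs_nonneg _, fun p x hx => ?_⟩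
    refine (hK p x (subset_closure hx)).trans ((le_abs_self _).trans ?_)
    exact Finset.single_le_sum (f := fun p => |K p|) (fun _ _ => abs_nonneg _) (Finset.mem_univ p)
  obtain ⟨N, hN0, hN⟩ : ∃ N : ℝ, 0 < N ∧ ∀ p : t, ‖v p‖ + 1 ≤ N := by
    refine ⟨(∑ p : t, ‖v p‖) + 1, by positivity, fun p => ?_⟩
    gcongr
    exact Finset.single_le_sum (f := fun p : t => ‖v p‖) (fun _ _ => norm_nonneg _)
      (Finset.mem_univ p)
  set B := (eLpNorm G 2 volume).toReal with hB
  have hB0 : 0 ≤ B := ENNReal.toReal_nonneg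
  set n : ℝ := (Fintype.card t : ℝ) with hn
  have hn0 : 0 ≤ n := Nat.cast_nonneg _
  -- Half of κ pays for the mollification errors, K + 1 times κ₁ in each of the n pieces. The other
  -- half pays for the compression error μ‖G‖.
  obtain ⟨κ₁, hκ₁, hnκ₁⟩ : ∃ κ₁ : ℝ, 0 < κ₁ ∧ n * ((K + 1) * κ₁) ≤ κ / 2 := by
    refine ⟨κ / (2 * (n * (K + 1) + 1)), by positivity, ?_⟩
    rw [← mul_assoc, mul_div_assoc', div_le_div_iff₀ (by positivity) (by norm_num)]
    nlinarith [mul_nonneg hn0 hK0]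
  have hκ₁' : ENNReal.ofReal κ₁ ≠ 0 := by simpa using hκ₁
  obtain ⟨ru, hru0, hru⟩ := exists_eLpNorm_normed_convolution_affineShift_sub_le hum huL hκ₁'
  obtain ⟨rG, hrG0, hrG⟩ := exists_eLpNorm_normed_convolution_affineShift_sub_le hGm hGL hκ₁'
  -- One bound on all displacements: r₁ serves the graph estimate, `ru` and `rG` the two L²
  -- estimates.
  set R := min r₁ (min ru rG) with hR
  have hR0 : 0 < R := by positivity
  have hM0 : 0 < M := hm0.trans_le hmM
  obtain ⟨μ, ε, hμ0, hμ1, hμR, hμB, hε0, hερ, hεR, hεη⟩ :=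
    exists_shift_parameters hα0' hm0 hM0 hR0 hκ hρ hn0 hB0 H N
  have hμm : 0 < μ * m := by positivity
  set δ := min (ε / 2) (μ * m / 8) with hδ
  have hδ0 : 0 < δ := by positivity
  have hδε : δ < ε := (min_le_left _ _).trans_lt (by linarith)
  have hδμ : δ ≤ μ * m / 8 := min_le_right _ _
  let bump : ContDiffBump (0 : 𝔼 × ℝ) := ⟨δ / 2, δ, by positivity, by linarith⟩
  have hbump : bump.rOut = δ := rfl
  set b : t → 𝔼 × ℝ := fun p => (ε • v p, μ * m / 4) with hb
  have hbR : ∀ p, ‖b p‖ + δ < R / 2 := fun p => by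
    have h1 : ‖b p‖ < R / 4 := by
      refine max_lt ?_ ?_
      · simp only [hb, norm_smul, Real.norm_of_nonneg hε0.le]
        nlinarith [hN p]
      · simp only [hb, Real.norm_of_nonneg (by positivity : 0 ≤ μ * m / 4)]
        nlinarith
    nlinarith
  have hRu : R ≤ ru := (min_le_right _ _).trans (min_le_left _ _)
  have hRG : R ≤ rG := (min_le_right _ _).trans (min_le_right _ _)
  have hR1 : R ≤ r₁ := min_le_left _ _
  have hμabs : |1 - μ - 1| < R := by
    rw [show 1 - μ - 1 = -μ by ring, abs_neg, abs_of_pos hμ0]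
    nlinarith
  set W := bump.normed volume ⋆[ContinuousLinearMap.lsmul ℝ ℝ, volume] u with hW
  set V := bump.normed volume ⋆[ContinuousLinearMap.lsmul ℝ ℝ, volume] G with hV
  have hWC : ContDiff ℝ 1 W := bump.hasCompactSupport_normed.contDiff_convolution_left
    (ContinuousLinearMap.lsmul ℝ ℝ) (bump.contDiff_normed (n := 1)) hui
  have hWu : ∀ p, eLpNorm (fun z => W (affineShift (1 - μ) (b p) z) - u z) 2 volume
      ≤ ENNReal.ofReal κ₁ := fun p =>
    hru _ _ bump (by linarith) (by rw [hbump]; linarith [hbR p])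
  have hVG : ∀ p, eLpNorm (fun z => V (affineShift (1 - μ) (b p) z) - G z) 2 volume
      ≤ ENNReal.ofReal κ₁ := fun p =>
    hrG _ _ bump (by linarith) (by rw [hbump]; linarith [hbR p])
  -- Wherever χ p does not vanish, x lies in the ball of `p`, so the direction `v p` is admissible
  -- there.
  have hsub : ∀ (p : t) (x : 𝔼) (θ : ℝ), x ∈ ω → χ p x ≠ 0 → 0 < θ → θ ≤ η x →
      closedBall (affineShift (1 - μ) (b p) (x, θ)) δ ⊆ Ω := fun p x θ hx hpx hθ0 hθ =>
    closedBall_affineShift_subset hη hm0 hx (hm x hx) hε0 (hN p) hδε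
      (hcone p p.2 x hx ((hχr p x hpx).trans_le (by linarith)) ε hε0 hερ) hμ0 hμ1 hεη hδμ hθ0 hθ
  have hVc : Continuous V := bump.hasCompactSupport_normed.continuous_convolution_left
    (ContinuousLinearMap.lsmul ℝ ℝ) bump.continuous_normed hGi
  have hcard : (Fintype.card t : ℝ≥0∞) = ENNReal.ofReal n := (ENNReal.ofReal_natCast _).symm
  have hBG : eLpNorm G 2 volume = ENNReal.ofReal B := (ENNReal.ofReal_toReal hGL.2.ne).symm
  refine ⟨patch χ W (1 - μ) b, contDiff_patch hχ hWC _ _, ?_, ?_, ?_⟩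
  · have h := eLpNorm_patch_sub_le hΩ hχ0 hχ1 (fun z hz => hχsum z.1 (subset_closure hz.1))
      hWC.continuous hum hWu
    refine (eLpNorm_congr_ae ?_).trans_le (h.trans ?_)
    · filter_upwards [self_mem_ae_restrict hΩ] with z hz
      rw [hu, indicator_of_mem hz]
    · rw [hcard, ← ENNReal.ofReal_mul hn0]
      refine ENNReal.ofReal_le_ofReal ?_
      nlinarith [mul_nonneg hn0 (mul_nonneg hK0 hκ₁.le)]
  · have h := eLpNorm_prodGradient_patch_sub_le hΩ hχ hχ0 hχ1 (fun z hz =>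
      Filter.mem_of_superset (hω.isOpen.mem_nhds hz.1) fun x hx => hχsum x (subset_closure hx))
      hWC hum hVc hGm (sub_nonneg.2 hμ1.le) (by linarith) hK0 (fun p z hz => hK p z.1 hz.1)
      (fun p z hz hp w => hweak.fderiv_normed_convolution hΩ hui hGi bump
        (hsub p z.1 z.2 hz.1 hp hz.2.1 hz.2.2.le) w) hWu hVG
    refine (eLpNorm_congr_ae ?_).trans_le (h.trans ?_)
    · filter_upwards [self_mem_ae_restrict hΩ] with z hz
      rw [hG, indicator_of_mem hz]
    · rw [hcard, hBG, sub_sub_cancel, ← ENNReal.ofReal_mul hK0, ← ENNReal.ofReal_mul hμ0.le,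
        ← ENNReal.ofReal_add (by positivity) (by positivity),
        ← ENNReal.ofReal_add (by positivity) (by positivity), ← ENNReal.ofReal_mul hn0]
      refine ENNReal.ofReal_le_ofReal ?_
      nlinarith
  · intro f hf κ' hκ' x hx
    have hηx : 0 < η x := hm0.trans_le (hm x hx)
    have hzc : (x, η x) ∈ closure Ω := graph_mem_closure_subgraphDomain hx hηx
    -- Taking z = w in the modulus hypothesis.
    have hκ'0 : 0 ≤ κ' := (abs_nonneg _).trans (hκ' _ hzc _ hzc (by rwa [dist_self]))
    refine abs_patch_sub_le hχ0 (hχsum x (subset_closure hx)) fun p hp => ?_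
    refine abs_normed_convolution_sub_le hΩ hum hf bump
      (hsub p x (η x) hx hp hηx le_rfl) hκ'0 fun y hyΩ hy => ?_
    refine hκ' _ hzc _ (subset_closure hyΩ) ?_
    have hAz := dist_affineShift_le (by linarith : 1 - μ ≤ 1) (b p) (x, η x) (M := M)
      (by rw [abs_of_pos hηx]; exact hM x hx)
    have := dist_triangle y (affineShift (1 - μ) (b p) (x, η x)) (x, η x)
    rw [hbump] at hy
    nlinarith [hbR p]

/-! ### `C¹` functions in H¹ and completeness of H^s -/

theorem ofReal_norm_sq_prod_Lp {X Y F₁ F₂ : Type*} [MeasurableSpace X] [MeasurableSpace Y]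
    [NormedAddCommGroup F₁] [NormedAddCommGroup F₂] {μ : Measure X} {ν : Measure Y}
    (V : WithLp 2 (Lp F₁ 2 μ × Lp F₂ 2 ν)) :
    ENNReal.ofReal (‖V‖ ^ 2) = (∫⁻ x, ‖V.fst x‖ₑ ^ 2 ∂μ) + ∫⁻ y, ‖V.snd y‖ₑ ^ 2 ∂ν := by
  rw [WithLp.prod_norm_sq_eq_of_L2, ENNReal.ofReal_add (by positivity) (by positivity),
    ENNReal.ofReal_pow (norm_nonneg _), ENNReal.ofReal_pow (norm_nonneg _), Lp.norm_def, Lp.norm_def,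
    ENNReal.ofReal_toReal (Lp.eLpNorm_ne_top _), ENNReal.ofReal_toReal (Lp.eLpNorm_ne_top _),
    eLpNorm_two_sq, eLpNorm_two_sq]

/-- The `C¹` functions on `ℝ^d × ℝ`. -/
def contDiffSubmodule (d : ℕ) : Submodule ℝ (EuclideanSpace ℝ (Fin d) × ℝ → ℝ) where
  carrier := {φ | ContDiff ℝ 1 φ}
  zero_mem' := (contDiff_const : ContDiff ℝ 1 fun _ => (0 : ℝ))
  add_mem' := fun {φ ψ} (hφ : ContDiff ℝ 1 φ) (hψ : ContDiff ℝ 1 ψ) => hφ.add hψ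
  smul_mem' := fun c φ (hφ : ContDiff ℝ 1 φ) => hφ.const_smul c

theorem contDiff_coe (φ : contDiffSubmodule d) : ContDiff ℝ 1 (φ : 𝔼 × ℝ → ℝ) := φ.2

theorem prodGradient_add {φ ψ : 𝔼 × ℝ → ℝ} (hφ : ContDiff ℝ 1 φ) (hψ : ContDiff ℝ 1 ψ) :
    prodGradient (φ + ψ) = prodGradient φ + prodGradient ψ := by
  ext1 z
  simp only [prodGradient, Pi.add_apply]
  rw [fderiv_add (hφ.differentiable one_ne_zero z) (hψ.differentiable one_ne_zero z),
    ContinuousLinearMap.add_comp, map_add]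

theorem prodGradient_smul {φ : 𝔼 × ℝ → ℝ} (c : ℝ) (hφ : ContDiff ℝ 1 φ) :
    prodGradient (c • φ) = c • prodGradient φ := by
  ext1 z
  simp only [prodGradient, Pi.smul_apply]
  rw [fderiv_const_smul (hφ.differentiable one_ne_zero z), ContinuousLinearMap.smul_comp,
    map_smulₛₗ]
  simp

theorem memLp_restrict_of_continuousOn_closure {X F : Type*} [PseudoMetricSpace X] [ProperSpace X]
    [SecondCountableTopology X] [MeasurableSpace X] [OpensMeasurableSpace X]
    [NormedAddCommGroup F] {μ : Measure X}
    [IsFiniteMeasureOnCompacts μ] {f : X → F} {s : Set X} (hs : MeasurableSet s)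
    (hb : Bornology.IsBounded s) (hf : ContinuousOn f (closure s)) :
    MemLp f 2 (μ.restrict s) := by
  obtain ⟨C, hC⟩ := hb.isCompact_closure.exists_bound_of_continuousOn hf
  have : IsFiniteMeasure (μ.restrict s) := ⟨by
    rw [Measure.restrict_apply_univ]
    exact (measure_mono subset_closure).trans_lt hb.isCompact_closure.measure_lt_top⟩
  exact MemLp.of_bound ((hf.mono subset_closure).aestronglyMeasurable hs) C
    ((ae_restrict_iff' hs).2 (Eventually.of_forall fun x hx => hC x (subset_closure hx)))

/-- The test function vanishes outside Ω, so both integrals extend to the whole space and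
integration by parts there has no boundary term. -/
theorem hasWeakGradient_prodGradient {Ω : Set (𝔼 × ℝ)} {φ : 𝔼 × ℝ → ℝ} (hφ : ContDiff ℝ 1 φ) :
    HasWeakGradient Ω φ (prodGradient φ) := by
  intro ψ hψ hψc hψΩ v
  have hψ1 : ContDiff ℝ 1 ψ := hψ.of_le (by exact_mod_cast le_top)
  have hφ' : Continuous fun z => fderiv ℝ φ z (v.fst, v.snd) :=
    (hφ.continuous_fderiv one_ne_zero).clm_apply continuous_const
  have hψ' : Continuous fun z => fderiv ℝ ψ z (v.fst, v.snd) :=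
    (hψ1.continuous_fderiv one_ne_zero).clm_apply continuous_const
  have hψ'c : HasCompactSupport fun z => fderiv ℝ ψ z (v.fst, v.snd) :=
    hψc.fderiv_apply ℝ (v.fst, v.snd)
  simp only [inner_prodGradient]
  rw [setIntegral_eq_integral_of_forall_compl_eq_zero, setIntegral_eq_integral_of_forall_compl_eq_zero]
  · refine integral_mul_fderiv_eq_neg_fderiv_mul_of_integrable ?_ ?_ ?_
      (fun z _ => hφ.differentiable one_ne_zero z) (fun z _ => hψ1.differentiable one_ne_zero z)
    · exact (hφ'.mul hψ.continuous).integrable_of_hasCompactSupport hψc.mul_left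
    · exact (hφ.continuous.mul hψ').integrable_of_hasCompactSupport hψ'c.mul_left
    · exact (hφ.continuous.mul hψ.continuous).integrable_of_hasCompactSupport hψc.mul_left
  · intro z hz
    rw [image_eq_zero_of_notMem_tsupport fun h => hz (hψΩ h), mul_zero]
  · intro z hz
    have : fderiv ℝ ψ z = 0 := by
      by_contra h
      exact hz (hψΩ (support_fderiv_subset ℝ h))
    rw [this]
    simp

theorem HasWeakGradient.congr_ae {Ω : Set (𝔼 × ℝ)} {u u' : 𝔼 × ℝ → ℝ}
    {G G' : 𝔼 × ℝ → WithLp 2 (𝔼 × ℝ)} (h : HasWeakGradient Ω u G)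
    (hu : u' =ᵐ[volume.restrict Ω] u) (hG : G' =ᵐ[volume.restrict Ω] G) :
    HasWeakGradient Ω u' G' := by
  intro ψ h1 h2 h3 v
  have e1 : ∫ z in Ω, u' z * fderiv ℝ ψ z (v.fst, v.snd)
      = ∫ z in Ω, u z * fderiv ℝ ψ z (v.fst, v.snd) := by
    refine integral_congr_ae ?_
    filter_upwards [hu] with z hz
    rw [hz]
  have e2 : ∫ z in Ω, inner ℝ (G' z) v * ψ z = ∫ z in Ω, inner ℝ (G z) v * ψ z := by
    refine integral_congr_ae ?_
    filter_upwards [hG] with z hz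
    rw [hz]
  rw [e1, e2, h ψ h1 h2 h3 v]

theorem exists_linearMap_H1 {Ω : Set (𝔼 × ℝ)} (hΩ : MeasurableSet Ω)
    (hb : Bornology.IsBounded Ω) :
    ∃ J : contDiffSubmodule d →ₗ[ℝ] H1 Ω, ∀ φ,
      (J φ).1.fst =ᵐ[volume.restrict Ω] φ.1 ∧
      (J φ).1.snd =ᵐ[volume.restrict Ω] prodGradient φ.1 := by
  have h1 : ∀ φ : contDiffSubmodule d, MemLp φ.1 2 (volume.restrict Ω) := fun φ =>
    memLp_restrict_of_continuousOn_closure hΩ hb (contDiff_coe φ).continuous.continuousOn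
  have h2 : ∀ φ : contDiffSubmodule d, MemLp (prodGradient φ.1) 2 (volume.restrict Ω) := fun φ =>
    memLp_restrict_of_continuousOn_closure hΩ hb (continuous_prodGradient (contDiff_coe φ)).continuousOn
  refine ⟨{ toFun := fun φ => ⟨WithLp.toLp 2 ((h1 φ).toLp, (h2 φ).toLp),
              (hasWeakGradient_prodGradient (contDiff_coe φ)).congr_ae (h1 φ).coeFn_toLp (h2 φ).coeFn_toLp⟩
            map_add' := fun φ ψ => ?_
            map_smul' := fun c φ => ?_ }, fun φ => ⟨(h1 φ).coeFn_toLp, (h2 φ).coeFn_toLp⟩⟩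
  · refine Subtype.ext (WithLp.ofLp_injective 2 (Prod.ext ?_ ?_))
    · exact MemLp.toLp_add (h1 φ) (h1 ψ)
    · exact (MemLp.toLp_congr (h2 (φ + ψ)) ((h2 φ).add (h2 ψ))
        (Eventually.of_forall fun z => congrFun (prodGradient_add (contDiff_coe φ) (contDiff_coe ψ)) z)).trans
        (MemLp.toLp_add (h2 φ) (h2 ψ))
  · refine Subtype.ext (WithLp.ofLp_injective 2 (Prod.ext ?_ ?_))
    · exact MemLp.toLp_const_smul c (h1 φ)
    · exact (MemLp.toLp_congr (h2 (c • φ)) ((h2 φ).const_smul c)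
        (Eventually.of_forall fun z => congrFun (prodGradient_smul c (contDiff_coe φ)) z)).trans
        (MemLp.toLp_const_smul c (h2 φ))

theorem slobodeckijQuotient_congr_ae {ω : Set 𝔼} (s : ℝ) {u w : 𝔼 → ℝ}
    (h : u =ᵐ[volume.restrict ω] w) :
    slobodeckijQuotient s u =ᵐ[(volume.restrict ω).prod (volume.restrict ω)]
      slobodeckijQuotient s w := by
  filter_upwards [Measure.quasiMeasurePreserving_fst (μ := volume.restrict ω)
    (ν := volume.restrict ω) |>.ae h, Measure.quasiMeasurePreserving_snd (μ := volume.restrict ω)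
    (ν := volume.restrict ω) |>.ae h] with p h1 h2
  simp only [slobodeckijQuotient, h1, h2]

theorem Hs_snd_ae_eq {ω : Set 𝔼} {s : ℝ} (U : Hs ω s) :
    U.1.snd =ᵐ[(volume.restrict ω).prod (volume.restrict ω)] slobodeckijQuotient s U.1.fst := U.2

/-- The second component is a function of the first. This makes maps into H^s linear, and equal, as
soon as their L² parts are. -/
theorem Hs_ext {ω : Set 𝔼} {s : ℝ} {U V : Hs ω s}
    (h : U.1.fst =ᵐ[volume.restrict ω] V.1.fst) : U = V := by
  refine Subtype.ext (WithLp.ofLp_injective 2 (Prod.ext (Lp.ext h) (Lp.ext ?_)))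
  exact ((Hs_snd_ae_eq U).trans (slobodeckijQuotient_congr_ae s h)).trans (Hs_snd_ae_eq V).symm

theorem exists_Hs_of_memLp {ω : Set 𝔼} {s : ℝ} {g : 𝔼 → ℝ} (hg : MemLp g 2 (volume.restrict ω))
    (hq : MemLp (slobodeckijQuotient s g) 2 ((volume.restrict ω).prod (volume.restrict ω))) :
    ∃ V : Hs ω s, V.1.fst =ᵐ[volume.restrict ω] g :=
  ⟨⟨WithLp.toLp 2 (hg.toLp, hq.toLp),
    hq.coeFn_toLp.trans (slobodeckijQuotient_congr_ae s hg.coeFn_toLp.symm)⟩, hg.coeFn_toLp⟩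

theorem aestronglyMeasurable_slobodeckijQuotient {ω : Set 𝔼} (s : ℝ) {g : 𝔼 → ℝ}
    (hg : AEStronglyMeasurable g (volume.restrict ω)) :
    AEStronglyMeasurable (slobodeckijQuotient s g)
      ((volume.restrict ω).prod (volume.restrict ω)) := by
  by_cases hs : s = 0
  · have : slobodeckijQuotient s g = fun _ => 0 := by
      ext p
      simp [slobodeckijQuotient, hs]
    rw [this]
    exact aestronglyMeasurable_const
  · have : slobodeckijQuotient s g
        = fun p => (g p.1 - g p.2) / ‖p.1 - p.2‖ ^ ((d : ℝ) / 2 + s) := by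
      ext p
      simp [slobodeckijQuotient, hs]
    rw [this]
    refine AEMeasurable.aestronglyMeasurable ?_
    refine (hg.comp_fst.sub hg.comp_snd).aemeasurable.div (Measurable.aemeasurable ?_)
    fun_prop

/-- L² limits are a.e. limits along a subsequence, and the difference quotient passes to a.e. limits
pointwise. -/
theorem isClosed_Hs (ω : Set 𝔼) (s : ℝ) : IsClosed (Hs ω s : Set (WithLp 2
    (Lp ℝ 2 (volume.restrict ω) × Lp ℝ 2 ((volume.restrict ω).prod (volume.restrict ω))))) := by
  refine IsSeqClosed.isClosed fun X Y hX hXY => ?_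
  have h1 : Tendsto (fun k => (X k).fst) atTop (𝓝 Y.fst) :=
    ((WithLp.prod_continuous_ofLp 2 _ _).fst.tendsto Y).comp hXY
  have h2 : Tendsto (fun k => (X k).snd) atTop (𝓝 Y.snd) :=
    ((WithLp.prod_continuous_ofLp 2 _ _).snd.tendsto Y).comp hXY
  obtain ⟨n₁, hn₁, hae₁⟩ := (tendstoInMeasure_of_tendsto_Lp h1).exists_seq_tendsto_ae
  -- Extracted from the first subsequence, so that both components converge a.e. along it.
  obtain ⟨n₂, hn₂, hae₂⟩ := (tendstoInMeasure_of_tendsto_Lp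
    (h2.comp hn₁.tendsto_atTop)).exists_seq_tendsto_ae
  have hX' : ∀ᵐ p ∂((volume.restrict ω).prod (volume.restrict ω)), ∀ k,
      (X k).snd p = slobodeckijQuotient s (X k).fst p := ae_all_iff.2 hX
  change Y.snd =ᵐ[_] slobodeckijQuotient s Y.fst
  filter_upwards [hX', hae₂, Measure.quasiMeasurePreserving_fst (μ := volume.restrict ω)
    (ν := volume.restrict ω) |>.ae hae₁, Measure.quasiMeasurePreserving_snd
    (μ := volume.restrict ω) (ν := volume.restrict ω) |>.ae hae₁] with p hp hp2 hp3 hp4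
  refine tendsto_nhds_unique hp2 ?_
  have hp3' := hp3.comp hn₂.tendsto_atTop
  have hp4' := hp4.comp hn₂.tendsto_atTop
  simp only [Function.comp_apply, hp, slobodeckijQuotient]
  split_ifs
  · exact tendsto_const_nhds
  · exact (hp3'.sub hp4').div_const _

theorem ofReal_norm_sq_of_ae_eq {X Y F₁ F₂ : Type*} [MeasurableSpace X] [MeasurableSpace Y]
    [NormedAddCommGroup F₁] [NormedAddCommGroup F₂] {μ : Measure X} {ν : Measure Y}
    {V : WithLp 2 (Lp F₁ 2 μ × Lp F₂ 2 ν)} {f : X → F₁} {g : Y → F₂} (hf : V.fst =ᵐ[μ] f)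
    (hg : V.snd =ᵐ[ν] g) :
    ENNReal.ofReal (‖V‖ ^ 2) = (∫⁻ x, ‖f x‖ₑ ^ 2 ∂μ) + ∫⁻ y, ‖g y‖ₑ ^ 2 ∂ν := by
  rw [ofReal_norm_sq_prod_Lp, ← eLpNorm_two_sq, ← eLpNorm_two_sq, eLpNorm_congr_ae hf,
    eLpNorm_congr_ae hg, eLpNorm_two_sq, eLpNorm_two_sq]

theorem eLpNorm_fst_le_norm {X Y F₁ F₂ : Type*} [MeasurableSpace X] [MeasurableSpace Y]
    [NormedAddCommGroup F₁] [NormedAddCommGroup F₂] {μ : Measure X} {ν : Measure Y}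
    (V : WithLp 2 (Lp F₁ 2 μ × Lp F₂ 2 ν)) : eLpNorm V.fst 2 μ ≤ ENNReal.ofReal ‖V‖ := by
  rw [← ENNReal.ofReal_toReal (Lp.eLpNorm_ne_top _), ← Lp.norm_def]
  refine ENNReal.ofReal_le_ofReal (abs_le_of_sq_le_sq' ?_ (norm_nonneg _)).2
  rw [WithLp.prod_norm_sq_eq_of_L2]
  exact le_add_of_nonneg_right (sq_nonneg _)

theorem norm_le_two_mul_of_eLpNorm_le {X Y F₁ F₂ : Type*} [MeasurableSpace X] [MeasurableSpace Y]
    [NormedAddCommGroup F₁] [NormedAddCommGroup F₂] {μ : Measure X} {ν : Measure Y}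
    {V : WithLp 2 (Lp F₁ 2 μ × Lp F₂ 2 ν)} {κ : ℝ} (hκ : 0 ≤ κ)
    (h1 : eLpNorm V.fst 2 μ ≤ ENNReal.ofReal κ) (h2 : eLpNorm V.snd 2 ν ≤ ENNReal.ofReal κ) :
    ‖V‖ ≤ 2 * κ := by
  have h1' : ‖V.fst‖ ≤ κ := by
    rw [Lp.norm_def]
    exact ENNReal.toReal_le_of_le_ofReal hκ h1
  have h2' : ‖V.snd‖ ≤ κ := by
    rw [Lp.norm_def]
    exact ENNReal.toReal_le_of_le_ofReal hκ h2
  refine abs_le_of_sq_le_sq' ?_ (by positivity) |>.2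
  rw [WithLp.prod_norm_sq_eq_of_L2]
  nlinarith [norm_nonneg V.fst, norm_nonneg V.snd]

theorem eLpNorm_Hs_fst_sub_le {ω : Set 𝔼} {s : ℝ} (V W : Hs ω s) :
    eLpNorm (fun x => V.1.fst x - W.1.fst x) 2 (volume.restrict ω) ≤ ENNReal.ofReal ‖V - W‖ := by
  refine (eLpNorm_congr_ae ?_).trans_le (eLpNorm_fst_le_norm (V - W).1)
  exact (Lp.coeFn_sub V.1.fst W.1.fst).symm

theorem eLpNorm_sub_le_add_sub {X : Type*} [MeasurableSpace X] {μ : Measure X} {a b c : X → ℝ}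
    (ha : AEStronglyMeasurable a μ) (hb : AEStronglyMeasurable b μ)
    (hc : AEStronglyMeasurable c μ) :
    eLpNorm (fun x => a x - c x) 2 μ
      ≤ eLpNorm (fun x => a x - b x) 2 μ + eLpNorm (fun x => b x - c x) 2 μ := by
  have e : (fun x => a x - c x) = (fun x => a x - b x) + fun x => b x - c x := by
    ext x
    simp
  rw [e]
  exact eLpNorm_add_le (ha.sub hb) (hb.sub hc) one_le_two

theorem ae_eq_of_forall_eLpNorm_sub_le {X : Type*} [MeasurableSpace X] {μ : Measure X}
    {a c : X → ℝ} (ha : AEStronglyMeasurable a μ) (hc : AEStronglyMeasurable c μ) {B : ℝ}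
    {A : ℝ≥0∞} (hA : A ≠ ∞) (h : ∀ κ : ℝ, 0 < κ → eLpNorm (fun x => a x - c x) 2 μ
      ≤ ENNReal.ofReal (B * (2 * κ)) + A * ENNReal.ofReal κ) : a =ᵐ[μ] c := by
  have hlim : Tendsto (fun κ : ℝ => ENNReal.ofReal (B * (2 * κ)) + A * ENNReal.ofReal κ)
      (𝓝[>] 0) (𝓝 0) := by
    have h1 : Tendsto (fun κ : ℝ => ENNReal.ofReal (B * (2 * κ))) (𝓝 0) (𝓝 0) := by
      have : Continuous fun κ : ℝ => ENNReal.ofReal (B * (2 * κ)) :=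
        ENNReal.continuous_ofReal.comp (by fun_prop)
      simpa using this.tendsto 0
    have h2 : Tendsto (fun κ : ℝ => A * ENNReal.ofReal κ) (𝓝 0) (𝓝 0) := by
      have := ENNReal.Tendsto.const_mul (ENNReal.continuous_ofReal.tendsto 0) (Or.inr hA)
      simpa using this
    simpa using (h1.add h2).mono_left nhdsWithin_le_nhds
  have h0 := ge_of_tendsto hlim (eventually_mem_nhdsWithin.mono h)
  filter_upwards [(eLpNorm_eq_zero_iff (ha.sub hc) two_ne_zero).1 (le_antisymm h0 bot_le)]
    with x hx
  exact sub_eq_zero.1 hx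

theorem norm_map_sub_le_of_norm_sub_le {E F : Type*} [NormedAddCommGroup E] [NormedSpace ℝ E]
    [NormedAddCommGroup F] [NormedSpace ℝ F] (T : E →L[ℝ] F) {x y : E} {c : ℝ}
    (h : ‖y - x‖ ≤ c) : ‖T x - T y‖ ≤ ‖T‖ * c := by
  rw [← map_sub]
  exact T.le_opNorm_of_le (by rwa [norm_sub_rev])

/-! ### The trace operator -/

section Trace

variable {ω : Set (EuclideanSpace ℝ (Fin d))} {α H : ℝ≥0} {η : EuclideanSpace ℝ (Fin d) → ℝ}
  {m M s : ℝ}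

/-- The trace inequality is what makes the difference quotient square integrable. -/
theorem exists_linearMap_Hs (hd : 1 ≤ d) (hω : IsLipschitzDomain ω) (hα0 : 0 < α) (hα1 : α < 1)
    (hη : HolderOnWith H α η (closure ω)) (hm0 : 0 < m) (hm : ∀ x ∈ ω, m ≤ η x)
    (hM : ∀ x ∈ ω, η x ≤ M) (hs0 : 0 ≤ s) (hs : s < (α : ℝ) / 2) :
    ∃ τ : contDiffSubmodule d →ₗ[ℝ] Hs ω s, ∀ φ,
      (τ φ).1.fst =ᵐ[volume.restrict ω] graphTrace η φ.1 := by
  have hηc := hη.continuousOn hα0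
  have hΩ := isBounded_subgraphDomain hω.isBounded hηc
  obtain ⟨C, hC⟩ :=
    exists_lintegral_slobodeckijQuotient_graphTrace_sq_le hd hω hα0 hα1 hη hm0 hm hM hs0 hs
  have hex : ∀ φ : contDiffSubmodule d, ∃ V : Hs ω s,
      V.1.fst =ᵐ[volume.restrict ω] graphTrace η φ.1 := by
    intro φ
    have hg : MemLp (graphTrace η φ.1) 2 (volume.restrict ω) :=
      memLp_restrict_of_continuousOn_closure hω.isOpen.measurableSet hω.isBounded
        ((contDiff_coe φ).continuous.comp_continuousOn (continuousOn_id.prodMk hηc))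
    refine exists_Hs_of_memLp hg
      ⟨aestronglyMeasurable_slobodeckijQuotient s hg.aestronglyMeasurable, ?_⟩
    have h1 : MemLp φ.1 2 (volume.restrict (subgraphDomain ω η)) :=
      memLp_restrict_of_continuousOn_closure
        (isOpen_subgraphDomain hω.isOpen (hηc.mono subset_closure)).measurableSet hΩ
        (contDiff_coe φ).continuous.continuousOn
    have h2 : MemLp (prodGradient φ.1) 2 (volume.restrict (subgraphDomain ω η)) :=
      memLp_restrict_of_continuousOn_closure
        (isOpen_subgraphDomain hω.isOpen (hηc.mono subset_closure)).measurableSet hΩ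
        (continuous_prodGradient (contDiff_coe φ)).continuousOn
    have h := hC φ.1 (contDiff_coe φ)
    rw [← eLpNorm_two_sq, ← eLpNorm_two_sq, ← eLpNorm_two_sq] at h
    have h3 := h.trans_lt (ENNReal.mul_lt_top ENNReal.coe_lt_top
      (ENNReal.add_lt_top.2 ⟨ENNReal.pow_lt_top h1.eLpNorm_lt_top,
        ENNReal.pow_lt_top h2.eLpNorm_lt_top⟩))
    exact (ENNReal.pow_lt_top_iff.1 h3).resolve_right two_ne_zero
  choose τ hτ using hex
  refine ⟨{ toFun := τ, map_add' := fun φ ψ => Hs_ext ?_, map_smul' := fun c φ => Hs_ext ?_ }, hτ⟩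
  · filter_upwards [hτ (φ + ψ), hτ φ, hτ ψ, Lp.coeFn_add (τ φ).1.fst (τ ψ).1.fst]
      with x h1 h2 h3 h4
    refine h1.trans (Eq.trans ?_ h4.symm)
    rw [Pi.add_apply, h2, h3]
    rfl
  · filter_upwards [hτ (c • φ), hτ φ, Lp.coeFn_smul c (τ φ).1.fst] with x h1 h2 h3
    refine h1.trans (Eq.trans ?_ h3.symm)
    rw [Pi.smul_apply, h2]
    rfl

theorem exists_norm_trace_le (hd : 1 ≤ d) (hω : IsLipschitzDomain ω) (hα0 : 0 < α) (hα1 : α < 1)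
    (hη : HolderOnWith H α η (closure ω)) (hm0 : 0 < m) (hm : ∀ x ∈ ω, m ≤ η x)
    (hM : ∀ x ∈ ω, η x ≤ M) (hs0 : 0 ≤ s) (hs : s < (α : ℝ) / 2) :
    ∃ C : ℝ, ∀ φ, ContDiff ℝ 1 φ → ∀ (U : H1 (subgraphDomain ω η)) (V : Hs ω s),
      U.1.fst =ᵐ[volume.restrict (subgraphDomain ω η)] φ →
      U.1.snd =ᵐ[volume.restrict (subgraphDomain ω η)] prodGradient φ →
      V.1.fst =ᵐ[volume.restrict ω] graphTrace η φ → ‖V‖ ≤ C * ‖U‖ := by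
  have hηc := hη.continuousOn hα0
  obtain ⟨C₁, hC₁⟩ := exists_lintegral_graphTrace_sq_le hω.isOpen.measurableSet
    (isOpen_subgraphDomain hω.isOpen (hηc.mono subset_closure)).measurableSet hm0 hm hM
  obtain ⟨C₂, hC₂⟩ :=
    exists_lintegral_slobodeckijQuotient_graphTrace_sq_le hd hω hα0 hα1 hη hm0 hm hM hs0 hs
  refine ⟨√(C₁ + C₂), fun φ hφ U V hU1 hU2 hV => ?_⟩
  have hV' := (Hs_snd_ae_eq V).trans (slobodeckijQuotient_congr_ae s hV)
  have hU_norm := ofReal_norm_sq_of_ae_eq hU1 hU2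
  have hV_norm := ofReal_norm_sq_of_ae_eq hV hV'
  have h : ENNReal.ofReal (‖V.1‖ ^ 2) ≤ ENNReal.ofReal ((C₁ + C₂) * ‖U.1‖ ^ 2) := by
    rw [ENNReal.ofReal_mul (by positivity)]
    refine hV_norm.trans_le ?_
    refine le_trans ?_ (mul_le_mul_right hU_norm.ge _)
    rw [ENNReal.ofReal_add (by positivity) (by positivity), ENNReal.ofReal_coe_nnreal,
      ENNReal.ofReal_coe_nnreal, add_mul]
    exact add_le_add (hC₁ φ hφ) (hC₂ φ hφ)
  rw [ENNReal.ofReal_le_ofReal_iff (by positivity)] at h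
  refine (abs_le_of_sq_le_sq' ?_ (by positivity)).2
  rw [mul_pow, Real.sq_sqrt (by positivity)]
  exact h

/-- Approximation in `H¹` by `C¹` functions, with simultaneous control of the traces of continuous
representatives. -/
theorem exists_contDiff_norm_sub_le (hω : IsLipschitzDomain ω) (hα0 : 0 < α)
    (hη : HolderOnWith H α η (closure ω)) (hm0 : 0 < m) (hm : ∀ x ∈ ω, m ≤ η x)
    (hM : ∀ x ∈ ω, η x ≤ M)
    {J : contDiffSubmodule d →ₗ[ℝ] H1 (subgraphDomain ω η)}
    (hJ : ∀ φ, (J φ).1.fst =ᵐ[volume.restrict (subgraphDomain ω η)] φ.1 ∧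
      (J φ).1.snd =ᵐ[volume.restrict (subgraphDomain ω η)] prodGradient φ.1)
    (U : H1 (subgraphDomain ω η)) {κ r : ℝ} (hκ : 0 < κ) (hr : 0 < r) :
    ∃ φ, ‖J φ - U‖ ≤ 2 * κ ∧ ∀ f, U.1.fst =ᵐ[volume.restrict (subgraphDomain ω η)] f → ∀ κ',
      (∀ z ∈ closure (subgraphDomain ω η), ∀ w ∈ closure (subgraphDomain ω η), dist w z < r →
        |f w - f z| ≤ κ') → ∀ x ∈ ω, |graphTrace η φ.1 x - graphTrace η f x| ≤ κ' := by
  obtain ⟨φ, hφ, h1, h2, h3⟩ := exists_contDiff_approx hω hα0 hη hm0 hm hM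
    (Lp.stronglyMeasurable U.1.fst) (Lp.stronglyMeasurable U.1.snd) (Lp.memLp U.1.fst)
    (Lp.memLp U.1.snd) U.2 hκ hr
  refine ⟨⟨φ, hφ⟩, norm_le_two_mul_of_eLpNorm_le hκ.le ?_ ?_, h3⟩
  · refine (eLpNorm_congr_ae ?_).trans_le h1
    refine (Lp.coeFn_sub (J ⟨φ, hφ⟩).1.fst U.1.fst).trans ?_
    filter_upwards [(hJ ⟨φ, hφ⟩).1] with z hz
    rw [Pi.sub_apply, hz]
  · refine (eLpNorm_congr_ae ?_).trans_le h2
    refine (Lp.coeFn_sub (J ⟨φ, hφ⟩).1.snd U.1.snd).trans ?_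
    filter_upwards [(hJ ⟨φ, hφ⟩).2] with z hz
    rw [Pi.sub_apply, hz]

theorem continuousOn_graphTrace (hη : ContinuousOn η ω) (hpos : ∀ x ∈ ω, 0 < η x)
    {f : EuclideanSpace ℝ (Fin d) × ℝ → ℝ} (hf : ContinuousOn f (closure (subgraphDomain ω η))) :
    ContinuousOn (graphTrace η f) ω :=
  hf.comp (continuousOn_id.prodMk hη) fun x hx => graph_mem_closure_subgraphDomain hx (hpos x hx)

set_option maxHeartbeats 1600000 in
-- A single `C¹` function φ is close to U in H¹ and close to f uniformly on the graph. Hence T U is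
-- L²-close to T(Jφ) = γφ by continuity of T, and γφ is L²-close to γf because ω has finite measure.
theorem trace_ae_eq_graphTrace (hω : IsLipschitzDomain ω) (hα0 : 0 < α)
    (hη : HolderOnWith H α η (closure ω)) (hm0 : 0 < m) (hm : ∀ x ∈ ω, m ≤ η x)
    (hM : ∀ x ∈ ω, η x ≤ M)
    {J : contDiffSubmodule d →ₗ[ℝ] H1 (subgraphDomain ω η)}
    (hJ : ∀ φ, (J φ).1.fst =ᵐ[volume.restrict (subgraphDomain ω η)] φ.1 ∧
      (J φ).1.snd =ᵐ[volume.restrict (subgraphDomain ω η)] prodGradient φ.1)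
    {T : H1 (subgraphDomain ω η) →L[ℝ] Hs ω s}
    (hT : ∀ φ, (T (J φ)).1.fst =ᵐ[volume.restrict ω] graphTrace η φ.1)
    {U : H1 (subgraphDomain ω η)} {f : EuclideanSpace ℝ (Fin d) × ℝ → ℝ}
    (hf : IsContinuousRep U f) : (T U).1.fst =ᵐ[volume.restrict ω] graphTrace η f := by
  have hηc := hη.continuousOn hα0
  have hΩ := isBounded_subgraphDomain hω.isBounded hηc
  have hfin : IsFiniteMeasure (volume.restrict ω) :=
    ⟨by rw [Measure.restrict_apply_univ]; exact hω.isBounded.measure_lt_top⟩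
  have hfm : AEStronglyMeasurable (graphTrace η f) (volume.restrict ω) :=
    (continuousOn_graphTrace (hηc.mono subset_closure) (fun x hx => hm0.trans_le (hm x hx))
      hf.1).aestronglyMeasurable hω.isOpen.measurableSet
  have hTm : ∀ V : Hs ω s, AEStronglyMeasurable V.1.fst (volume.restrict ω) :=
    fun V => Lp.aestronglyMeasurable _
  have huc := hΩ.isCompact_closure.uniformContinuousOn_of_continuous hf.1
  rw [Metric.uniformContinuousOn_iff] at huc
  have hA : (volume.restrict ω univ) ^ (2 : ℝ≥0∞).toReal⁻¹ ≠ ∞ :=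
    ENNReal.rpow_ne_top_of_nonneg (by positivity) (measure_ne_top _ _)
  refine ae_eq_of_forall_eLpNorm_sub_le (hTm (T U)) hfm (B := ‖T‖) hA fun κ hκ => ?_
  -- Uniform continuity of f on the compact closure supplies the radius within which the
  -- approximation may average.
  obtain ⟨r, hr, hfr⟩ := huc κ hκ
  obtain ⟨φ, hφ1, hφ2⟩ := exists_contDiff_norm_sub_le hω hα0 hη hm0 hm hM hJ U hκ hr
  have hφ3 := hφ2 f hf.2 κ fun z hz w hw hd => by
    have := (hfr w hw z hz hd).le
    rwa [Real.dist_eq] at this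
  have hTJ : ∀ᵐ x ∂volume.restrict ω, ‖(T (J φ)).1.fst x - graphTrace η f x‖ ≤ κ := by
    filter_upwards [hT φ, ae_restrict_mem hω.isOpen.measurableSet] with x h1 h2
    rw [h1]
    exact hφ3 x h2
  have hTU : ‖T U - T (J φ)‖ ≤ ‖T‖ * (2 * κ) :=
    norm_map_sub_le_of_norm_sub_le T hφ1
  exact (eLpNorm_sub_le_add_sub (hTm (T U)) (hTm (T (J φ))) hfm).trans
    (add_le_add ((eLpNorm_Hs_fst_sub_le _ _).trans (ENNReal.ofReal_le_ofReal hTU))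
      (eLpNorm_le_of_ae_bound hTJ))

end Trace

end

set_option maxHeartbeats 1600000 in
/-- With `d = n - 1 ≥ 1`. The functions of `H¹(Ω_η)` that are continuous up
to the boundary are dense, and there is exactly one bounded linear operator `H¹(Ω_η) → H^s(ω)` that
is `γ_η` on them. -/
theorem theorem1 {d : ℕ} (hd : 1 ≤ d) {ω : Set (EuclideanSpace ℝ (Fin d))}
    (hω : IsLipschitzDomain ω) {α : ℝ≥0} (hα0 : 0 < α) (hα1 : α < 1)
    {η : EuclideanSpace ℝ (Fin d) → ℝ} (hη : ∃ C : ℝ≥0, HolderOnWith C α η (closure ω))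
    {ηmin : ℝ} (hmin0 : 0 < ηmin) (hmin : ∀ x ∈ closure ω, ηmin ≤ η x)
    (hη1 : ∀ x ∈ frontier ω, η x = 1) {s : ℝ} (hs0 : 0 ≤ s) (hs : s < (α : ℝ) / 2) :
    Dense {U : H1 (subgraphDomain ω η) | ∃ f, IsContinuousRep U f} ∧
    ∃! T : H1 (subgraphDomain ω η) →L[ℝ] Hs ω s,
      ∀ (U : H1 (subgraphDomain ω η)) (f : EuclideanSpace ℝ (Fin d) × ℝ → ℝ),
        IsContinuousRep U f → (T U).1.fst =ᵐ[volume.restrict ω] graphTrace η f := by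
  obtain ⟨H, hη⟩ := hη
  have hηc := hη.continuousOn hα0
  obtain ⟨M, hM'⟩ := hω.isBounded.isCompact_closure.exists_bound_of_continuousOn hηc
  have hM : ∀ x ∈ ω, η x ≤ M := fun x hx =>
    (le_abs_self _).trans (hM' x (subset_closure hx))
  have hm : ∀ x ∈ ω, ηmin ≤ η x := fun x hx => hmin x (subset_closure hx)
  obtain ⟨J, hJ⟩ := exists_linearMap_H1
    (isOpen_subgraphDomain hω.isOpen (hηc.mono subset_closure)).measurableSet
    (isBounded_subgraphDomain hω.isBounded hηc)
  obtain ⟨τ, hτ⟩ := exists_linearMap_Hs hd hω hα0 hα1 hη hmin0 hm hM hs0 hs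
  obtain ⟨C, hC⟩ := exists_norm_trace_le hd hω hα0 hα1 hη hmin0 hm hM hs0 hs
  have hdense : DenseRange J := by
    intro U
    refine Metric.mem_closure_iff.2 fun ε hε => ?_
    -- The approximation error is 2κ = ε/2. The radius plays no role for density, so 1 is used.
    obtain ⟨φ, hφ, -⟩ := exists_contDiff_norm_sub_le hω hα0 hη hmin0 hm hM hJ U
      (κ := ε / 4) (by positivity) one_pos
    refine ⟨J φ, Set.mem_range_self φ, ?_⟩
    exact ((dist_comm U (J φ)).trans (dist_eq_norm _ _)).trans_lt (hφ.trans_lt (by linarith))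
  have hdense' : Dense {U : H1 (subgraphDomain ω η) | ∃ f, IsContinuousRep U f} := by
    refine Dense.mono ?_ hdense
    rintro _ ⟨φ, rfl⟩
    exact ⟨φ.1, (contDiff_coe φ).continuous.continuousOn, (hJ φ).1⟩
  -- Completeness of the target is what the extension along the dense map J requires.
  have hcomp : CompleteSpace (Hs ω s) := (isClosed_Hs ω s).completeSpace_coe
  have hτJ : ∀ φ, τ.extendOfNorm J (J φ) = τ φ := LinearMap.extendOfNorm_eq hdense
    ⟨C, fun φ => hC φ.1 (contDiff_coe φ) (J φ) (τ φ) (hJ φ).1 (hJ φ).2 (hτ φ)⟩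
  have hT : ∀ (U : H1 (subgraphDomain ω η)) f, IsContinuousRep U f →
      (τ.extendOfNorm J U).1.fst =ᵐ[volume.restrict ω] graphTrace η f := fun U f hf =>
    trace_ae_eq_graphTrace hω hα0 hη hmin0 hm hM hJ (fun φ => (hτJ φ).symm ▸ hτ φ) hf
  refine ⟨hdense', τ.extendOfNorm J, hT, fun T' hT' => ?_⟩
  refine DFunLike.coe_injective (Continuous.ext_on hdense' T'.continuous
    (τ.extendOfNorm J).continuous ?_)
  rintro U ⟨f, hf⟩
  exact Hs_ext ((hT' U f hf).trans (hT U f hf).symm)
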